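/- Let $S\subset\mathbf{R}^n$ be a smooth, compact, connected hypersurface without boundary, and let $\nu$ be a continuous unit normal field on $S$ (for instance the outward unit normal). For every $h>0$ let $g_1^h,g_2^h:S\to\mathbf{R}$ be smooth positive functions, and put $$S^h=\{x+t\,\nu(x)\;:\;x\in S,\ -g_1^h(x)<t<g_2^h(x)\}.$$ Assume that there are constants $C_1,C_2,C_3>0$ and $h_0>0$ such that for all $0<h<h_0$, all $x\in S$ and $i=1,2$, $$C_1h\le g_i^h(x)\le C_2h,\qquad |\nabla g_i^h(x)|\le C_3h,$$ where $\nabla g_i^h$ is the (tangential) gradient on $S$. Then there are $C>0$ and $\bar h>0$, depending only on $S$, $C_1$, $C_2$, $C_3$, such that for every $0<h<\min(h_0,\bar h)$ and every $u\in W^{1,2}(S^h,\mathbf{R})$ there exists a constant $a\in\mathbf{R}$ with $$\|u-a\|_{L^2(S^h)}\le C\,\|\nabla u\|_{L^2(S^h)}.$$ In particular $C$ is independent of $h$, $a$ and $u$. -/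

import Mathlib

open MeasureTheory Set
open scoped ContDiff

noncomputable section

/-- `S ⊆ ℝⁿ` is a smooth embedded hypersurface without boundary: near each of its points it is the
zero set of a smooth function whose differential does not vanish at that point. -/
def IsSmoothHypersurface {n : ℕ} (S : Set (EuclideanSpace ℝ (Fin n))) : Prop :=
  ∀ x ∈ S, ∃ (U : Set (EuclideanSpace ℝ (Fin n))) (φ : EuclideanSpace ℝ (Fin n) → ℝ),
    IsOpen U ∧ x ∈ U ∧ ContDiffOn ℝ ∞ φ U ∧ fderiv ℝ φ x ≠ 0 ∧ S ∩ U = {y ∈ U | φ y = 0}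

/-- The tangent space `T_x S`, as a linear subspace of `ℝⁿ`. -/
def surfaceTangentSpace {n : ℕ} (S : Set (EuclideanSpace ℝ (Fin n)))
    (x : EuclideanSpace ℝ (Fin n)) : Submodule ℝ (EuclideanSpace ℝ (Fin n)) :=
  Submodule.span ℝ (tangentConeAt ℝ S x)

/-- `ν` is a continuous unit normal field on `S`. (On a connected hypersurface there are at most two
of these, `ν` and `-ν`.) -/
structure IsUnitNormalField {n : ℕ} (S : Set (EuclideanSpace ℝ (Fin n)))
    (ν : EuclideanSpace ℝ (Fin n) → EuclideanSpace ℝ (Fin n)) : Prop where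
  continuousOn : ContinuousOn ν S
  norm_eq_one : ∀ x ∈ S, ‖ν x‖ = 1
  normal : ∀ x ∈ S, ∀ τ ∈ surfaceTangentSpace S x, inner ℝ (ν x) τ = 0

/-- The restriction of `g` to `S` is smooth: it has a smooth extension near each point of `S`. -/
def IsSmoothOnSurface {n : ℕ} (S : Set (EuclideanSpace ℝ (Fin n)))
    (g : EuclideanSpace ℝ (Fin n) → ℝ) : Prop :=
  ∀ x ∈ S, ∃ (U : Set (EuclideanSpace ℝ (Fin n))) (G : EuclideanSpace ℝ (Fin n) → ℝ),
    IsOpen U ∧ x ∈ U ∧ ContDiffOn ℝ ∞ G U ∧ ∀ y ∈ S ∩ U, G y = g y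

/-- `w = ∇g(x)`, the gradient at `x` of the function `g` on the surface `S`: the tangent vector `w`
with `g(y) = g(x) + ⟨w, y - x⟩ + o(|y - x|)` as `y → x` in `S`. -/
def IsSurfaceGradientAt {n : ℕ} (S : Set (EuclideanSpace ℝ (Fin n)))
    (g : EuclideanSpace ℝ (Fin n) → ℝ) (x w : EuclideanSpace ℝ (Fin n)) : Prop :=
  w ∈ surfaceTangentSpace S x ∧ HasGradientWithinAt g w S x

/-- A family `(g^h)_{h > 0}` of smooth positive functions on `S`. -/
def IsSmoothPositiveFamily {n : ℕ} (S : Set (EuclideanSpace ℝ (Fin n)))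
    (g : ℝ → EuclideanSpace ℝ (Fin n) → ℝ) : Prop :=
  ∀ h : ℝ, 0 < h → IsSmoothOnSurface S (g h) ∧ ∀ x ∈ S, 0 < g h x

/-- For all `0 < h < h₀` and all `x ∈ S`: `C₁ h ≤ g^h(x) ≤ C₂ h` and `|∇g^h(x)| ≤ C₃ h`. -/
def ThicknessBounds {n : ℕ} (S : Set (EuclideanSpace ℝ (Fin n)))
    (g : ℝ → EuclideanSpace ℝ (Fin n) → ℝ) (C₁ C₂ C₃ h₀ : ℝ) : Prop :=
  ∀ h : ℝ, 0 < h → h < h₀ → ∀ x ∈ S, C₁ * h ≤ g h x ∧ g h x ≤ C₂ * h ∧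
    ∃ w, IsSurfaceGradientAt S (g h) x w ∧ ‖w‖ ≤ C₃ * h

/-- The shell `{x + t ν(x) : x ∈ S, -a(x) < t < b(x)}` around `S`. -/
def thinShell {n : ℕ} (S : Set (EuclideanSpace ℝ (Fin n)))
    (ν : EuclideanSpace ℝ (Fin n) → EuclideanSpace ℝ (Fin n))
    (a b : EuclideanSpace ℝ (Fin n) → ℝ) : Set (EuclideanSpace ℝ (Fin n)) :=
  {z | ∃ x ∈ S, ∃ t : ℝ, -a x < t ∧ t < b x ∧ z = x + t • ν x}

/-- `u ∈ W^{1,2}(Ω)` with weak gradient `G`, for an open set `Ω ⊆ ℝⁿ`: both `u` and `G` are square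
integrable on `Ω`, and `∫_Ω u ∂_v ψ = - ∫_Ω ⟨G, v⟩ ψ` for all smooth `ψ` with compact support in
`Ω` and all directions `v`. -/
structure IsSobolevWithGradient {n : ℕ} (Ω : Set (EuclideanSpace ℝ (Fin n)))
    (u : EuclideanSpace ℝ (Fin n) → ℝ)
    (G : EuclideanSpace ℝ (Fin n) → EuclideanSpace ℝ (Fin n)) : Prop where
  memLp : MemLp u 2 (volume.restrict Ω)
  memLp_gradient : MemLp G 2 (volume.restrict Ω)
  integral_by_parts : ∀ ψ : EuclideanSpace ℝ (Fin n) → ℝ, ContDiff ℝ ∞ ψ → HasCompactSupport ψ →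
    tsupport ψ ⊆ Ω → ∀ v : EuclideanSpace ℝ (Fin n),
      ∫ z in Ω, u z * fderiv ℝ ψ z v = -∫ z in Ω, inner ℝ (G z) v * ψ z

end

/-! Over a small patch of the surface, normal coordinates followed by an affine stretch in the
normal direction present the shell as the image of a fixed convex cylinder. The upper bounds on the
heights and their gradients bound the derivative of this parametrization independently of `h`. Its
Jacobian lies between `C₁ * h / 2` and `2 * (C₂ * h)`, so it is of order `h` with a controlled
ratio. The normal direction is compressed but never stretched by more than a constant, hence the
Poincaré inequality of the cylinder passes to the shell and all powers of `h` cancel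
(`IsShellChart.exists_hasFDerivAt_shellMap`, `IsShellChart.poincare_sobolev`).

On the convex cylinder the inequality is proved for the double integral of `‖v z - v w‖ₑ ^ 2`, by
integrating the gradient along segments (`poincare_convex`). This pairwise form involves no mean
value, so it survives a change of variables, and by Fatou it survives the passage from
mollifications to Sobolev functions (`pairwise_poincare_of_smooth`). Averaging in one variable then
gives the constant (`exists_const_of_pairwise_poincare`).

Finitely many patches cover the compact surface. When two patches meet, the overlap of their shells
occupies a proportion of the volume bounded below uniformly in `h`, so the two constants differ by a
controlled amount and the inequalities glue (`lintegral_union_le_of_overlap`). Connectedness lets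
the gluing exhaust the cover. Only injectivity within each patch is used, so no global tubular
neighbourhood enters. -/

open scoped ENNReal

/-! ### Poincaré inequalities on convex sets -/

/-- Jensen's inequality for the square, on a probability space. -/
theorem sq_lintegral_le_lintegral_sq {α : Type*} [MeasurableSpace α] (μ : Measure α)
    [IsProbabilityMeasure μ] {f : α → ℝ≥0∞} (hf : AEMeasurable f μ) :
    (∫⁻ x, f x ∂μ) ^ 2 ≤ ∫⁻ x, f x ^ 2 ∂μ := by
  have h := ENNReal.lintegral_mul_le_Lp_mul_Lq μ Real.HolderConjugate.two_two hf
    (aemeasurable_const (b := (1 : ℝ≥0∞)))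
  simp only [Pi.mul_apply, mul_one, ENNReal.one_rpow, lintegral_const, measure_univ] at h
  calc (∫⁻ x, f x ∂μ) ^ 2 ≤ ((∫⁻ x, f x ^ (2 : ℝ) ∂μ) ^ (1 / 2 : ℝ)) ^ 2 := by gcongr
    _ = ∫⁻ x, f x ^ 2 ∂μ := by
      rw [← ENNReal.rpow_natCast, ← ENNReal.rpow_mul]
      norm_num

/-- A differentiable function on `[0, 1]` whose derivative is dominated by a continuous function. -/
theorem enorm_sub_sq_le_lintegral {F F' b : ℝ → ℝ} (hF : ∀ s ∈ Icc (0 : ℝ) 1, HasDerivAt F (F' s) s)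
    (hb : ContinuousOn b (Icc 0 1)) (hFb : ∀ s ∈ Icc (0 : ℝ) 1, |F' s| ≤ b s) :
    ‖F 1 - F 0‖ₑ ^ 2 ≤ ∫⁻ s in Icc (0 : ℝ) 1, ENNReal.ofReal (b s) ^ 2 := by
  have hprob : IsProbabilityMeasure (volume.restrict (Icc (0 : ℝ) 1)) := ⟨by simp⟩
  have hbm : AEMeasurable b (volume.restrict (Icc (0 : ℝ) 1)) := hb.aemeasurable measurableSet_Icc
  -- `F'` is arbitrary outside the interval; on it `F'` equals `deriv F`, which is always
  -- measurable.
  have hF'm : AEStronglyMeasurable F' (volume.restrict (Icc (0 : ℝ) 1)) := by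
    refine ((stronglyMeasurable_deriv F).aestronglyMeasurable).congr ?_
    filter_upwards [ae_restrict_mem measurableSet_Icc] with s hs
    exact (hF s hs).deriv
  have hint : IntegrableOn F' (Icc 0 1) := by
    refine Integrable.mono' (hb.integrableOn_compact isCompact_Icc) hF'm ?_
    filter_upwards [ae_restrict_mem measurableSet_Icc] with s hs
    exact hFb s hs
  have h1 : ∫ s in (0 : ℝ)..1, F' s = F 1 - F 0 := by
    refine intervalIntegral.integral_eq_sub_of_hasDerivAt ?_ ?_
    · intro s hs
      rw [uIcc_of_le zero_le_one] at hs
      exact hF s hs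
    · rw [intervalIntegrable_iff_integrableOn_Icc_of_le zero_le_one]
      exact hint
  refine le_trans ?_ (sq_lintegral_le_lintegral_sq _ hbm.ennreal_ofReal)
  gcongr
  rw [← h1, intervalIntegral.integral_of_le zero_le_one, ← integral_Icc_eq_integral_Ioc]
  refine (enorm_integral_le_lintegral_enorm _).trans ?_
  refine setLIntegral_mono' measurableSet_Icc fun s hs => ?_
  rw [Real.enorm_eq_ofReal_abs]
  exact ENNReal.ofReal_le_ofReal (hFb s hs)

section

variable {E : Type*} [NormedAddCommGroup E] [InnerProductSpace ℝ E] [FiniteDimensional ℝ E]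
  [MeasurableSpace E] [BorelSpace E]

/-- The contraction towards `w` maps the convex set into itself with Jacobian `(1 - s) ^ d`, where
`d` is the dimension. For `s ≤ 1 / 2` this is at least `2 ^ (-d)`, which is the only loss in
changing variables. -/
theorem setLIntegral_comp_homothety_le {D : Set E} (hD : Convex ℝ D) (hDm : MeasurableSet D)
    {w : E} (hw : w ∈ D) {s : ℝ} (hs0 : 0 ≤ s) (hs : s ≤ 1 / 2) (φ : E → ℝ≥0∞) :
    ∫⁻ z in D, φ (z + s • (w - z)) ≤ 2 ^ Module.finrank ℝ E * ∫⁻ z in D, φ z := by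
  set f : E → E := fun z => z + s • (w - z) with hf
  have hd : ∀ z ∈ D, HasFDerivWithinAt f ((1 - s) • ContinuousLinearMap.id ℝ E) D z := by
    intro z _
    have h : HasFDerivAt f (ContinuousLinearMap.id ℝ E + s • (0 - ContinuousLinearMap.id ℝ E)) z :=
      (hasFDerivAt_id z).add (((hasFDerivAt_const w z).sub (hasFDerivAt_id z)).const_smul s)
    convert h.hasFDerivWithinAt using 1
    module
  have hinj : InjOn f D := by
    intro z _ z' _ h
    have : (1 - s) • (z - z') = 0 := by
      have h2 : (1 - s) • (z - z') = (z + s • (w - z)) - (z' + s • (w - z')) := by module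
      rw [h2, sub_eq_zero]
      exact h
    rcases smul_eq_zero.1 this with h | h
    · linarith
    · exact sub_eq_zero.1 h
  have himg : f '' D ⊆ D := by
    rintro _ ⟨z, hz, rfl⟩
    exact hD.add_smul_sub_mem hz hw ⟨hs0, by linarith⟩
  have key := lintegral_image_eq_lintegral_abs_det_fderiv_mul volume hDm hd hinj φ
  have hdet : ((1 - s) • ContinuousLinearMap.id ℝ E).det = (1 - s) ^ Module.finrank ℝ E := by
    simp [ContinuousLinearMap.det]
  calc ∫⁻ z in D, φ (f z)
      ≤ ∫⁻ z in D, 2 ^ Module.finrank ℝ E *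
          (ENNReal.ofReal |((1 - s) • ContinuousLinearMap.id ℝ E).det| * φ (f z)) := by
        refine lintegral_mono fun z => ?_
        rw [hdet, ← mul_assoc, abs_of_nonneg (pow_nonneg (by linarith) _),
          ENNReal.ofReal_pow (by linarith), ← mul_pow]
        refine le_mul_of_one_le_left zero_le (one_le_pow₀ ?_)
        rw [← ENNReal.ofReal_ofNat 2, ← ENNReal.ofReal_mul (by norm_num)]
        exact ENNReal.one_le_ofReal.2 (by linarith)
    _ = 2 ^ Module.finrank ℝ E * ∫⁻ z in f '' D, φ z := by
        rw [lintegral_const_mul' _ _ (by simp), key]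
    _ ≤ _ := by gcongr

/-- The Poincaré inequality on a convex set, for a function with an upper gradient. -/
theorem poincare_convex {D : Set E} (hD : Convex ℝ D) (hDm : MeasurableSet D) {γ : E → ℝ≥0∞}
    (hγ : Measurable γ) {c : ℝ≥0∞} {v : E → ℝ}
    (hv : ∀ z ∈ D, ∀ w ∈ D, ‖v z - v w‖ₑ ^ 2 ≤
      c * ∫⁻ s in Icc (0 : ℝ) 1, γ (z + s • (w - z))) :
    ∫⁻ z in D, ∫⁻ w in D, ‖v z - v w‖ₑ ^ 2 ≤
      c * 2 ^ (Module.finrank ℝ E + 1) * volume D * ∫⁻ z in D, γ z := by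
  set I := ∫⁻ z in D, γ z
  set K : ℝ≥0∞ := 2 ^ Module.finrank ℝ E
  have hs : ∀ s ∈ Icc (0 : ℝ) 1, ∫⁻ z in D, ∫⁻ w in D, γ (z + s • (w - z)) ≤ K * volume D * I := by
    intro s hs
    -- A point of the segment from `z` to `w` moves non-degenerately with at least one endpoint. For
    -- small `s` the variable `z` is substituted with `w` frozen; for large `s` the roles are
    -- exchanged and `1 - s` is the parameter.
    rcases le_total s (1 / 2) with h | h
    · rw [lintegral_lintegral_swap (by fun_prop)]
      calc ∫⁻ w in D, ∫⁻ z in D, γ (z + s • (w - z)) ≤ ∫⁻ w in D, K * I :=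
            setLIntegral_mono' hDm fun w hw => setLIntegral_comp_homothety_le hD hDm hw hs.1 h γ
        _ = K * volume D * I := by rw [setLIntegral_const]; ring
    · calc ∫⁻ z in D, ∫⁻ w in D, γ (z + s • (w - z)) ≤ ∫⁻ z in D, K * I := by
            refine setLIntegral_mono' hDm fun z hz => ?_
            refine le_trans (le_of_eq ?_) (setLIntegral_comp_homothety_le hD hDm hz
              (s := 1 - s) (by linarith [hs.2]) (by linarith) γ)
            refine lintegral_congr fun w => ?_
            congr 1
            module
        _ = K * volume D * I := by rw [setLIntegral_const]; ring
  calc ∫⁻ z in D, ∫⁻ w in D, ‖v z - v w‖ₑ ^ 2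
      ≤ ∫⁻ z in D, ∫⁻ w in D, c * ∫⁻ s in Icc (0 : ℝ) 1, γ (z + s • (w - z)) :=
        setLIntegral_mono' hDm fun z hz => setLIntegral_mono' hDm fun w hw => hv z hz w hw
    _ = c * ∫⁻ s in Icc (0 : ℝ) 1, ∫⁻ z in D, ∫⁻ w in D, γ (z + s • (w - z)) := by
        have h1 : ∀ z, ∫⁻ w in D, c * ∫⁻ s in Icc (0 : ℝ) 1, γ (z + s • (w - z)) =
            c * ∫⁻ s in Icc (0 : ℝ) 1, ∫⁻ w in D, γ (z + s • (w - z)) := by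
          intro z
          rw [lintegral_const_mul, lintegral_lintegral_swap (by fun_prop)]
          exact Measurable.lintegral_prod_right' (f := fun p : E × ℝ => γ (z + p.2 • (p.1 - z)))
            (by fun_prop)
        simp_rw [h1]
        have h2 : Measurable fun p : E × ℝ => ∫⁻ w in D, γ (p.1 + p.2 • (w - p.1)) :=
          Measurable.lintegral_prod_right'
            (f := fun q : (E × ℝ) × E => γ (q.1.1 + q.1.2 • (q.2 - q.1.1))) (by fun_prop)
        rw [lintegral_const_mul, lintegral_lintegral_swap h2.aemeasurable]
        exact h2.lintegral_prod_right'
    _ ≤ c * ∫⁻ s in Icc (0 : ℝ) 1, K * volume D * I := by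
        gcongr c * ?_
        exact setLIntegral_mono' measurableSet_Icc hs
    _ = c * K * volume D * I := by
        rw [setLIntegral_const]; simp; ring
    -- The exponent `d` already suffices; the additional factor two is slack.
    _ ≤ _ := by
        gcongr
        exact pow_le_pow_right₀ (by norm_num) (Nat.le_succ _)

/-- The Poincaré inequality for `f ∘ Φ` on a convex set, `Φ` with bounded derivative. -/
theorem poincare_comp {D : Set E} (hD : Convex ℝ D) (hDo : IsOpen D) {Φ : E → E}
    {Φ' : E → E →L[ℝ] E} (hΦ : ∀ z ∈ D, HasFDerivAt Φ (Φ' z) z) {L R : ℝ} (hL : 0 ≤ L)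
    (hΦ' : ∀ z ∈ D, ‖Φ' z‖ ≤ L) (hR : ∀ z ∈ D, ∀ w ∈ D, ‖w - z‖ ≤ R)
    {f : E → ℝ} (hf : ContDiff ℝ 1 f) :
    ∫⁻ z in D, ∫⁻ w in D, ‖f (Φ z) - f (Φ w)‖ₑ ^ 2 ≤
      ENNReal.ofReal (L * R) ^ 2 * 2 ^ (Module.finrank ℝ E + 1) * volume D *
        ∫⁻ z in D, ‖fderiv ℝ f (Φ z)‖ₑ ^ 2 := by
  have hcont : ContinuousOn (fun z => fderiv ℝ f (Φ z)) D :=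
    (hf.continuous_fderiv one_ne_zero).comp_continuousOn
      fun z hz => (hΦ z hz).continuousAt.continuousWithinAt
  -- Nothing is known about `Φ` off `D`. Cutting off makes the upper gradient measurable everywhere,
  -- and segments between points of `D` never see the cutoff.
  set γ : E → ℝ≥0∞ := D.indicator fun z => ‖fderiv ℝ f (Φ z)‖ₑ ^ 2 with hγ
  have hγm : Measurable γ := by
    refine measurable_of_restrict_of_restrict_compl hDo.measurableSet ?_ ?_
    · have : D.domRestrict γ = D.domRestrict fun z => ‖fderiv ℝ f (Φ z)‖ₑ ^ 2 := by
        ext z; simp [hγ]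
      rw [this]
      have h2 : Continuous (D.domRestrict fun z => ‖fderiv ℝ f (Φ z)‖ₑ ^ 2) := by
        have := continuousOn_iff_continuous_domRestrict.1 hcont
        exact (ENNReal.continuous_pow 2).comp this.enorm
      exact h2.measurable
    · have : Dᶜ.domRestrict γ = fun _ => 0 := by
        ext z; simp [hγ, indicator_of_notMem z.2]
      rw [this]
      exact measurable_const
  have hγD : ∫⁻ z in D, γ z = ∫⁻ z in D, ‖fderiv ℝ f (Φ z)‖ₑ ^ 2 :=
    setLIntegral_congr_fun hDo.measurableSet fun z hz => by simp [hγ, hz]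
  rw [← hγD]
  refine poincare_convex hD hDo.measurableSet hγm fun z hz w hw => ?_
  have hmem : ∀ s ∈ Icc (0 : ℝ) 1, z + s • (w - z) ∈ D := fun s hs => hD.add_smul_sub_mem hz hw hs
  have hline : ∀ s : ℝ, HasDerivAt (fun s : ℝ => z + s • (w - z)) (w - z) s := fun s => by
    simpa using ((hasDerivAt_id s).smul_const (w - z)).const_add z
  have h := enorm_sub_sq_le_lintegral (F := fun s => f (Φ (z + s • (w - z))))
    (F' := fun s => fderiv ℝ f (Φ (z + s • (w - z))) (Φ' (z + s • (w - z)) (w - z)))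
    (b := fun s => ‖fderiv ℝ f (Φ (z + s • (w - z)))‖ * (L * R)) ?_ ?_ ?_
  · simp only [one_smul, zero_smul, add_zero, add_sub_cancel] at h
    rw [← enorm_neg, neg_sub]
    refine h.trans ?_
    rw [← lintegral_const_mul' _ _ (by simp)]
    refine setLIntegral_mono' measurableSet_Icc fun s hs => ?_
    rw [ENNReal.ofReal_mul (norm_nonneg _), ofReal_norm, mul_pow, mul_comm]
    simp [hγ, hmem s hs]
  · intro s hs
    have h1 := (hΦ _ (hmem s hs)).comp_hasDerivAt s (hline s)
    exact ((hf.differentiable one_ne_zero) _).hasFDerivAt.comp_hasDerivAt s h1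
  · refine ContinuousOn.mul (ContinuousOn.norm ?_) continuousOn_const
    exact hcont.comp (by fun_prop) hmem
  · intro s hs
    calc _ ≤ ‖fderiv ℝ f (Φ (z + s • (w - z)))‖ * ‖Φ' (z + s • (w - z)) (w - z)‖ :=
          ContinuousLinearMap.le_opNorm _ _
      _ ≤ _ := by
          gcongr
          exact (ContinuousLinearMap.le_opNorm _ _).trans
            (mul_le_mul (hΦ' _ (hmem s hs)) (hR z hz w hw) (norm_nonneg _) hL)

end

/-! ### Mollification and the passage to Sobolev functions -/

section Mollification

open Convolution Filter Topology

variable {n : ℕ}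

/-- The mollification of `u` restricted to `Ω` (and extended by zero). -/
noncomputable def mollify (Ω : Set (EuclideanSpace ℝ (Fin n))) (u : EuclideanSpace ℝ (Fin n) → ℝ)
    (φ : ContDiffBump (0 : EuclideanSpace ℝ (Fin n))) : EuclideanSpace ℝ (Fin n) → ℝ :=
  Ω.indicator u ⋆[ContinuousLinearMap.lsmul ℝ ℝ, volume] φ.normed volume

variable {Ω : Set (EuclideanSpace ℝ (Fin n))} {u : EuclideanSpace ℝ (Fin n) → ℝ}
  {G : EuclideanSpace ℝ (Fin n) → EuclideanSpace ℝ (Fin n)}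

theorem locallyIntegrable_indicator (hΩ : IsOpen Ω) (hu : MemLp u 2 (volume.restrict Ω)) :
    LocallyIntegrable (Ω.indicator u) volume :=
  ((memLp_indicator_iff_restrict hΩ.measurableSet).2 hu).locallyIntegrable (by norm_num)

theorem contDiff_mollify (hΩ : IsOpen Ω) (hu : MemLp u 2 (volume.restrict Ω))
    (φ : ContDiffBump (0 : EuclideanSpace ℝ (Fin n))) : ContDiff ℝ ∞ (mollify Ω u φ) :=
  φ.hasCompactSupport_normed.contDiff_convolution_right _ (locallyIntegrable_indicator hΩ hu)
    φ.contDiff_normed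

theorem tendsto_mollify (hΩ : IsOpen Ω) (hu : MemLp u 2 (volume.restrict Ω))
    {φ : ℕ → ContDiffBump (0 : EuclideanSpace ℝ (Fin n))} {K : ℝ}
    (hφ : Tendsto (fun k => (φ k).rOut) atTop (𝓝 0)) (hK : ∀ k, (φ k).rOut ≤ K * (φ k).rIn) :
    ∀ᵐ x, Tendsto (fun k => mollify Ω u (φ k) x) atTop (𝓝 (Ω.indicator u x)) := by
  filter_upwards [ContDiffBump.ae_convolution_tendsto_right_of_locallyIntegrable
    (μ := volume) hφ (Eventually.of_forall hK) (locallyIntegrable_indicator hΩ hu)] with x hx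
  refine hx.congr fun k => ?_
  rw [mollify, convolution_def, convolution_eq_swap]
  simp [mul_comm]

/-- When the ball around `x` lies in `Ω`, the reflected and translated kernel is an admissible test
function. Its derivative in `z` is minus that of the kernel, which cancels the sign in the
integration by parts. -/
theorem fderiv_mollify_apply (hΩ : IsOpen Ω) (h : IsSobolevWithGradient Ω u G)
    (φ : ContDiffBump (0 : EuclideanSpace ℝ (Fin n))) {x : EuclideanSpace ℝ (Fin n)}
    (hx : Metric.closedBall x φ.rOut ⊆ Ω) (v : EuclideanSpace ℝ (Fin n)) :
    fderiv ℝ (mollify Ω u φ) x v = ∫ z in Ω, inner ℝ (G z) v * φ.normed volume (x - z) := by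
  have hloc := locallyIntegrable_indicator hΩ h.memLp
  have hρ : ContDiff ℝ ∞ (φ.normed volume) := φ.contDiff_normed
  have hρ1 : ContDiff ℝ 1 (φ.normed volume) := φ.contDiff_normed
  have hd := φ.hasCompactSupport_normed.hasFDerivAt_convolution_right (μ := volume)
    (ContinuousLinearMap.lsmul ℝ ℝ) hloc hρ1 x
  have hex := (φ.hasCompactSupport_normed.fderiv ℝ).convolutionExists_right
    ((ContinuousLinearMap.lsmul ℝ ℝ).precompR (EuclideanSpace ℝ (Fin n))) hloc
    (hρ1.continuous_fderiv one_ne_zero) x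
  rw [mollify, hd.fderiv, convolution_def, ContinuousLinearMap.integral_apply hex]
  have hψ : ContDiff ℝ ∞ fun z => φ.normed volume (x - z) := hρ.comp (contDiff_const.sub contDiff_id)
  have hsupp : tsupport (fun z => φ.normed volume (x - z)) ⊆ Metric.closedBall x φ.rOut := by
    refine closure_minimal ?_ Metric.isClosed_closedBall
    intro z hz
    have : x - z ∈ Function.support (φ.normed volume) := hz
    rw [φ.support_normed_eq] at this
    simp only [mem_ball_zero_iff] at this
    rw [Metric.mem_closedBall, dist_comm, dist_eq_norm]
    exact this.le
  have key := h.integral_by_parts _ hψ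
    ((isCompact_closedBall x φ.rOut).of_isClosed_subset (isClosed_tsupport _) hsupp)
    (hsupp.trans hx) v
  have hfd : ∀ z, fderiv ℝ (fun z => φ.normed volume (x - z)) z v =
      -fderiv ℝ (φ.normed volume) (x - z) v := by
    intro z
    have h1 := ((hρ1.differentiable one_ne_zero) (x - z)).hasFDerivAt.comp z
      ((hasFDerivAt_const x z).sub (hasFDerivAt_id z))
    have h2 : HasFDerivAt (fun z => φ.normed volume (x - z)) _ z := h1
    rw [h2.fderiv]
    simp
  simp only [hfd, mul_neg, integral_neg, neg_inj] at key
  rw [← key, ← integral_indicator hΩ.measurableSet]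
  refine integral_congr_ae (Eventually.of_forall fun z => ?_)
  by_cases hz : z ∈ Ω <;> simp [ContinuousLinearMap.precompR, hz]

theorem lintegral_normed_eq_one (φ : ContDiffBump (0 : EuclideanSpace ℝ (Fin n))) :
    ∫⁻ z, ENNReal.ofReal (φ.normed volume z) = 1 := by
  rw [← ofReal_integral_eq_lintegral_ofReal φ.integrable_normed
    (Eventually.of_forall fun z => φ.nonneg_normed z), φ.integral_normed, ENNReal.ofReal_one]

/-- The gradient of the mollification is an average of `G` against the probability density given by
the kernel, so Jensen's inequality applies. -/
theorem enorm_fderiv_mollify_sq_le (hΩ : IsOpen Ω) (h : IsSobolevWithGradient Ω u G)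
    (φ : ContDiffBump (0 : EuclideanSpace ℝ (Fin n))) {x : EuclideanSpace ℝ (Fin n)}
    (hx : Metric.closedBall x φ.rOut ⊆ Ω) :
    ‖fderiv ℝ (mollify Ω u φ) x‖ₑ ^ 2 ≤
      ∫⁻ z, ENNReal.ofReal (φ.normed volume (x - z)) * ‖Ω.indicator G z‖ₑ ^ 2 := by
  set k : EuclideanSpace ℝ (Fin n) → ℝ := fun z => φ.normed volume (x - z) with hk
  have hkc : Continuous k := φ.continuous_normed.comp (continuous_const.sub continuous_id)
  have hk0 : ∀ z, 0 ≤ k z := fun z => φ.nonneg_normed _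
  have hG : AEStronglyMeasurable (Ω.indicator G) volume :=
    (aestronglyMeasurable_indicator_iff hΩ.measurableSet).2 h.memLp_gradient.1
  have hprob : IsProbabilityMeasure (volume.withDensity fun z => ENNReal.ofReal (k z)) := by
    refine ⟨?_⟩
    rw [withDensity_apply _ MeasurableSet.univ, Measure.restrict_univ, ← lintegral_normed_eq_one φ]
    exact lintegral_sub_left_eq_self (fun z => ENNReal.ofReal (φ.normed volume z)) x
  have hkm : Measurable fun z => ENNReal.ofReal (k z) := hkc.measurable.ennreal_ofReal
  have hac : (volume.withDensity fun z => ENNReal.ofReal (k z)) ≪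
      (volume : Measure (EuclideanSpace ℝ (Fin n))) := withDensity_absolutelyContinuous _ _
  have hjensen := sq_lintegral_le_lintegral_sq (volume.withDensity fun z => ENNReal.ofReal (k z))
    (f := fun z => ‖Ω.indicator G z‖ₑ) (hG.enorm.mono_ac hac)
  rw [lintegral_withDensity_eq_lintegral_mul₀ hkm.aemeasurable hG.enorm,
    lintegral_withDensity_eq_lintegral_mul₀ hkm.aemeasurable (hG.enorm.pow_const 2)] at hjensen
  refine le_trans ?_ hjensen
  gcongr
  set I := ∫⁻ z, ENNReal.ofReal (k z) * ‖Ω.indicator G z‖ₑ with hI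
  change _ ≤ I
  rcases eq_or_ne I ⊤ with hItop | hItop
  · rw [hItop]; exact le_top
  rw [← ofReal_norm, ENNReal.ofReal_le_iff_le_toReal hItop]
  refine ContinuousLinearMap.opNorm_le_bound _ ENNReal.toReal_nonneg fun v => ?_
  rw [fderiv_mollify_apply hΩ h φ hx]
  rw [← ENNReal.ofReal_le_ofReal_iff (by positivity), ofReal_norm]
  refine (enorm_integral_le_lintegral_enorm _).trans ?_
  rw [ENNReal.ofReal_mul ENNReal.toReal_nonneg, ENNReal.ofReal_toReal hItop, hI,
    ← lintegral_mul_const' _ _ ENNReal.ofReal_ne_top, ← lintegral_indicator hΩ.measurableSet]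
  refine lintegral_mono fun z => ?_
  by_cases hz : z ∈ Ω
  · simp only [indicator_of_mem hz]
    rw [enorm_mul, Real.enorm_eq_ofReal (hk0 z), mul_comm, mul_assoc]
    gcongr
    rw [← ofReal_norm, ← ofReal_norm, ← ENNReal.ofReal_mul (norm_nonneg _)]
    exact ENNReal.ofReal_le_ofReal (norm_inner_le_norm _ _)
  · simp [indicator_of_notMem hz]

/-- After Tonelli, the kernel integrates to one in `x`, so mollifying does not increase the energy.
This gives constant one in the limit. -/
theorem lintegral_enorm_fderiv_mollify_sq_le (hΩ : IsOpen Ω) (h : IsSobolevWithGradient Ω u G)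
    (φ : ContDiffBump (0 : EuclideanSpace ℝ (Fin n))) {A : Set (EuclideanSpace ℝ (Fin n))}
    (hAm : MeasurableSet A) (hA : ∀ x ∈ A, Metric.closedBall x φ.rOut ⊆ Ω) :
    ∫⁻ x in A, ‖fderiv ℝ (mollify Ω u φ) x‖ₑ ^ 2 ≤ ∫⁻ z in Ω, ‖G z‖ₑ ^ 2 := by
  have hG : AEStronglyMeasurable (Ω.indicator G) volume :=
    (aestronglyMeasurable_indicator_iff hΩ.measurableSet).2 h.memLp_gradient.1
  have hρ : Measurable fun p : EuclideanSpace ℝ (Fin n) × EuclideanSpace ℝ (Fin n) =>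
      ENNReal.ofReal (φ.normed volume (p.1 - p.2)) :=
    (φ.continuous_normed.comp (continuous_fst.sub continuous_snd)).measurable.ennreal_ofReal
  calc ∫⁻ x in A, ‖fderiv ℝ (mollify Ω u φ) x‖ₑ ^ 2
      ≤ ∫⁻ x in A, ∫⁻ z, ENNReal.ofReal (φ.normed volume (x - z)) * ‖Ω.indicator G z‖ₑ ^ 2 :=
        setLIntegral_mono' hAm fun x hx => enorm_fderiv_mollify_sq_le hΩ h φ (hA x hx)
    _ ≤ ∫⁻ x, ∫⁻ z, ENNReal.ofReal (φ.normed volume (x - z)) * ‖Ω.indicator G z‖ₑ ^ 2 :=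
        setLIntegral_le_lintegral _ _
    _ = ∫⁻ z, ∫⁻ x, ENNReal.ofReal (φ.normed volume (x - z)) * ‖Ω.indicator G z‖ₑ ^ 2 := by
        refine lintegral_lintegral_swap (hρ.aemeasurable.mul ?_)
        exact (hG.enorm.pow_const 2).comp_quasiMeasurePreserving
          Measure.quasiMeasurePreserving_snd
    _ = ∫⁻ z, ‖Ω.indicator G z‖ₑ ^ 2 := by
        refine lintegral_congr fun z => ?_
        have h1 : Measurable fun x => ENNReal.ofReal (φ.normed volume (x - z)) :=
          (φ.continuous_normed.comp (continuous_id.sub continuous_const)).measurable.ennreal_ofReal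
        have h2 : ∫⁻ x, ENNReal.ofReal (φ.normed volume (x - z)) = 1 :=
          (lintegral_sub_right_eq_self (fun x => ENNReal.ofReal (φ.normed volume x)) z).trans
            (lintegral_normed_eq_one φ)
        rw [lintegral_mul_const _ h1, h2, one_mul]
    _ = ∫⁻ z in Ω, ‖G z‖ₑ ^ 2 := by
        rw [← lintegral_indicator hΩ.measurableSet]
        refine lintegral_congr fun z => ?_
        by_cases hz : z ∈ Ω <;> simp [hz]

/-- A pairwise Poincaré inequality for smooth functions on compactly exhausting subsets of `A`
extends to Sobolev functions. -/
theorem pairwise_poincare_of_smooth (hΩ : IsOpen Ω) (h : IsSobolevWithGradient Ω u G)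
    {A : Set (EuclideanSpace ℝ (Fin n))} {Ak K : ℕ → Set (EuclideanSpace ℝ (Fin n))}
    (hAΩ : A ⊆ Ω) (hAm : MeasurableSet A)
    (hK : ∀ k, IsCompact (K k)) (hKΩ : ∀ k, K k ⊆ Ω) (hAK : ∀ k, Ak k ⊆ K k)
    (hAkm : ∀ k, MeasurableSet (Ak k)) (hlim : ∀ x ∈ A, ∀ᶠ k in atTop, x ∈ Ak k) {C : ℝ≥0∞}
    (hC : ∀ k, ∀ f : EuclideanSpace ℝ (Fin n) → ℝ, ContDiff ℝ ∞ f →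
      ∫⁻ z in Ak k, ∫⁻ w in Ak k, ‖f z - f w‖ₑ ^ 2 ≤ C * ∫⁻ z in Ak k, ‖fderiv ℝ f z‖ₑ ^ 2) :
    ∫⁻ z in A, ∫⁻ w in A, ‖u z - u w‖ₑ ^ 2 ≤ C * ∫⁻ z in Ω, ‖G z‖ₑ ^ 2 := by
  have hδ : ∀ k, ∃ δ : ℝ, 0 < δ ∧ ∀ x ∈ K k, Metric.closedBall x δ ⊆ Ω := by
    intro k
    obtain ⟨δ, hδ0, hδ⟩ := (hK k).exists_cthickening_subset_open hΩ (hKΩ k)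
    exact ⟨δ, hδ0, fun x hx => (Metric.closedBall_subset_cthickening hx δ).trans hδ⟩
  choose δ hδ0 hδ using hδ
  have hη0 : ∀ k : ℕ, 0 < min (δ k) (1 / ((k : ℝ) + 1)) := fun k =>
    lt_min (hδ0 k) (by positivity)
  -- The outer radius stays within the room `δ k` around `K k` and tends to zero. The inner radius
  -- is half of it, so the supports shrink with bounded eccentricity, as Lebesgue differentiation
  -- requires.
  set φ : ℕ → ContDiffBump (0 : EuclideanSpace ℝ (Fin n)) := fun k =>
    ⟨min (δ k) (1 / ((k : ℝ) + 1)) / 2, min (δ k) (1 / ((k : ℝ) + 1)), half_pos (hη0 k),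
      half_lt_self (hη0 k)⟩ with hφ
  have hφlim : Tendsto (fun k => (φ k).rOut) atTop (𝓝 0) :=
    squeeze_zero (fun k => (hη0 k).le) (fun k => min_le_right _ _)
      tendsto_one_div_add_atTop_nhds_zero_nat
  have hae := tendsto_mollify hΩ h.memLp hφlim (K := 2) fun k => by
    change _ ≤ 2 * (_ / 2)
    rw [mul_div_cancel₀ _ two_ne_zero]
  set f := fun k => mollify Ω u (φ k) with hf
  have hfs : ∀ k, ContDiff ℝ ∞ (f k) := fun k => contDiff_mollify hΩ h.memLp (φ k)
  set F : ℕ → EuclideanSpace ℝ (Fin n) → EuclideanSpace ℝ (Fin n) → ℝ≥0∞ := fun k z w =>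
    (Ak k).indicator 1 z * ((Ak k).indicator 1 w * ‖f k z - f k w‖ₑ ^ 2) with hF
  have hFm : ∀ k, Measurable fun p : EuclideanSpace ℝ (Fin n) × EuclideanSpace ℝ (Fin n) =>
      F k p.1 p.2 := by
    intro k
    have h1 : Measurable ((Ak k).indicator (1 : EuclideanSpace ℝ (Fin n) → ℝ≥0∞)) :=
      measurable_one.indicator (hAkm k)
    have h2 := (hfs k).continuous.measurable
    have h3 : Measurable fun p : EuclideanSpace ℝ (Fin n) × EuclideanSpace ℝ (Fin n) =>
      ‖f k p.1 - f k p.2‖ₑ := ((h2.comp measurable_fst).sub (h2.comp measurable_snd)).enorm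
    exact (h1.comp measurable_fst).mul ((h1.comp measurable_snd).mul (h3.pow_const 2))
  have hFle : ∀ k, ∫⁻ z, ∫⁻ w, F k z w ≤ C * ∫⁻ z in Ω, ‖G z‖ₑ ^ 2 := by
    intro k
    have hind : ∀ (g : EuclideanSpace ℝ (Fin n) → ℝ≥0∞),
        ∫⁻ z, (Ak k).indicator 1 z * g z = ∫⁻ z in Ak k, g z := by
      intro g
      rw [← lintegral_indicator (hAkm k)]
      refine lintegral_congr fun z => ?_
      by_cases hz : z ∈ Ak k <;> simp [hz]
    have : ∫⁻ z, ∫⁻ w, F k z w = ∫⁻ z in Ak k, ∫⁻ w in Ak k, ‖f k z - f k w‖ₑ ^ 2 := by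
      rw [← hind]
      refine lintegral_congr fun z => ?_
      rw [← hind, ← lintegral_const_mul']
      by_cases hz : z ∈ Ak k <;> simp [hz]
    rw [this]
    refine (hC k _ (hfs k)).trans ?_
    gcongr C * ?_
    refine lintegral_enorm_fderiv_mollify_sq_le hΩ h (φ k) (hAkm k) fun x hx => ?_
    exact (Metric.closedBall_subset_closedBall (min_le_left _ _)).trans (hδ k x (hAK k hx))
  -- Almost every pair in `A` eventually lies in `Ak k`, where the mollified differences converge.
  -- Fatou's lemma is then applied in each variable.
  have hpt : ∀ᵐ z, z ∈ A → ∀ᵐ w, w ∈ A →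
      ‖u z - u w‖ₑ ^ 2 ≤ liminf (fun k => F k z w) atTop := by
    filter_upwards [hae] with z hz hzA
    filter_upwards [hae] with w hw hwA
    rw [indicator_of_mem (hAΩ hzA)] at hz
    rw [indicator_of_mem (hAΩ hwA)] at hw
    have h1 : Tendsto (fun k => ‖f k z - f k w‖ₑ ^ 2) atTop (𝓝 (‖u z - u w‖ₑ ^ 2)) :=
      ((ENNReal.continuous_pow 2).tendsto _).comp (hz.sub hw).enorm
    refine (Tendsto.liminf_eq (h1.congr' ?_)).ge
    filter_upwards [hlim z hzA, hlim w hwA] with k h2 h3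
    simp [hF, h2, h3]
  calc ∫⁻ z in A, ∫⁻ w in A, ‖u z - u w‖ₑ ^ 2
      ≤ ∫⁻ z in A, liminf (fun k => ∫⁻ w, F k z w) atTop := by
        refine setLIntegral_mono_ae' hAm ?_
        filter_upwards [hpt] with z hz hzA
        calc ∫⁻ w in A, ‖u z - u w‖ₑ ^ 2 ≤ ∫⁻ w in A, liminf (fun k => F k z w) atTop :=
              setLIntegral_mono_ae' hAm (hz hzA)
          _ ≤ ∫⁻ w, liminf (fun k => F k z w) atTop := setLIntegral_le_lintegral _ _
          _ ≤ _ := lintegral_liminf_le fun k => (hFm k).comp measurable_prodMk_left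
    _ ≤ ∫⁻ z, liminf (fun k => ∫⁻ w, F k z w) atTop := setLIntegral_le_lintegral _ _
    _ ≤ liminf (fun k => ∫⁻ z, ∫⁻ w, F k z w) atTop :=
        lintegral_liminf_le fun k => (hFm k).lintegral_prod_right'
    _ ≤ _ := liminf_le_of_frequently_le' (Eventually.of_forall hFle).frequently

/-- Some value of `u` is a good constant, if a pairwise Poincaré inequality holds. -/
theorem exists_const_of_pairwise_poincare {α : Type*} [MeasurableSpace α] {μ : Measure α}
    [SFinite μ] {A : Set α} {u : α → ℝ} (hA0 : μ A ≠ 0) (hA1 : μ A ≠ ⊤)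
    (hu : AEStronglyMeasurable u (μ.restrict A)) {T c : ℝ≥0∞} (hc : T ≤ c * μ A)
    (h : ∫⁻ z in A, ∫⁻ w in A, ‖u z - u w‖ₑ ^ 2 ∂μ ∂μ ≤ T) :
    ∃ a : ℝ, ∫⁻ w in A, ‖u w - a‖ₑ ^ 2 ∂μ ≤ c := by
  have hm : AEMeasurable (fun z => ∫⁻ w in A, ‖u z - u w‖ₑ ^ 2 ∂μ) (μ.restrict A) := by
    refine AEMeasurable.lintegral_prod_right' (f := fun p : α × α => ‖u p.1 - u p.2‖ₑ ^ 2) ?_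
    exact ((hu.comp_quasiMeasurePreserving Measure.quasiMeasurePreserving_fst).sub
      (hu.comp_quasiMeasurePreserving Measure.quasiMeasurePreserving_snd)).enorm.pow_const 2
  -- Some point has inner integral at most the average over `A`; its value of `u` serves as the
  -- constant.
  obtain ⟨x, -, hx⟩ := exists_le_setLAverage hA0 hA1 hm
  refine ⟨u x, ?_⟩
  have : ∫⁻ w in A, ‖u w - u x‖ₑ ^ 2 ∂μ = ∫⁻ w in A, ‖u x - u w‖ₑ ^ 2 ∂μ := by
    refine lintegral_congr fun w => ?_
    rw [← enorm_neg, neg_sub]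
  rw [this]
  refine hx.trans ?_
  rw [setLAverage_eq]
  exact ENNReal.div_le_of_le_mul (h.trans hc)

end Mollification

/-! ### Level sets, tangent directions and smoothness of the normal -/

section NormalField

open Filter Topology

variable {n : ℕ}

/-- The gradient in coordinates. -/
noncomputable def coordGradient (φ : EuclideanSpace ℝ (Fin n) → ℝ) (y : EuclideanSpace ℝ (Fin n)) :
    EuclideanSpace ℝ (Fin n) :=
  ∑ i, fderiv ℝ φ y (EuclideanSpace.basisFun (Fin n) ℝ i) • EuclideanSpace.basisFun (Fin n) ℝ i

theorem inner_coordGradient (φ : EuclideanSpace ℝ (Fin n) → ℝ) (y v : EuclideanSpace ℝ (Fin n)) :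
    inner ℝ (coordGradient φ y) v = fderiv ℝ φ y v := by
  conv_rhs => rw [← (EuclideanSpace.basisFun (Fin n) ℝ).sum_repr' v, map_sum]
  rw [coordGradient, sum_inner]
  refine Finset.sum_congr rfl fun i _ => ?_
  rw [real_inner_smul_left, map_smul, smul_eq_mul, mul_comm]

theorem coordGradient_ne_zero {φ : EuclideanSpace ℝ (Fin n) → ℝ} {y : EuclideanSpace ℝ (Fin n)}
    (h : fderiv ℝ φ y ≠ 0) : coordGradient φ y ≠ 0 := by
  contrapose! h
  ext v
  rw [← inner_coordGradient, h, inner_zero_left]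
  rfl

theorem contDiffAt_coordGradient {φ : EuclideanSpace ℝ (Fin n) → ℝ} {y : EuclideanSpace ℝ (Fin n)}
    (h : ContDiffAt ℝ ∞ φ y) : ContDiffAt ℝ ∞ (coordGradient φ) y := by
  have h1 : ContDiffAt ℝ ∞ (fderiv ℝ φ) y := h.fderiv_right (by norm_num)
  exact ContDiffAt.sum fun i _ => (h1.clm_apply contDiffAt_const).smul contDiffAt_const

/-- Straightening of a level set: local coordinates with derivative the identity at the given point,
in which `φ` is linear. -/
theorem exists_straightening {U : Set (EuclideanSpace ℝ (Fin n))}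
    {φ : EuclideanSpace ℝ (Fin n) → ℝ} (hU : IsOpen U) {y : EuclideanSpace ℝ (Fin n)} (hy : y ∈ U)
    (hφ : ContDiffOn ℝ ∞ φ U) (hd : fderiv ℝ φ y ≠ 0) (h0 : φ y = 0) :
    ∃ F : OpenPartialHomeomorph (EuclideanSpace ℝ (Fin n)) (EuclideanSpace ℝ (Fin n)),
      y ∈ F.source ∧ F.source ⊆ U ∧ F y = 0 ∧
      (∀ z, inner ℝ (coordGradient φ y) (F z) = φ z) ∧
      HasFDerivAt F.symm (ContinuousLinearMap.id ℝ (EuclideanSpace ℝ (Fin n))) 0 ∧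
      ContDiffAt ℝ ∞ F.symm 0 := by
  set a := coordGradient φ y with ha
  have ha0 : inner ℝ a a ≠ (0 : ℝ) := inner_self_ne_zero.2 (coordGradient_ne_zero hd)
  have hφy : ContDiffAt ℝ ∞ φ y := hφ.contDiffAt (hU.mem_nhds hy)
  -- The component of `z - y` along the gradient `a` is replaced by `φ z`, up to the factor `(inner
  -- ℝ a a)⁻¹`. To first order at `y` the two agree, so the derivative there is the identity.
  set f : EuclideanSpace ℝ (Fin n) → EuclideanSpace ℝ (Fin n) := fun z =>
    (z - y) + ((inner ℝ a a)⁻¹ * (φ z - inner ℝ a (z - y))) • a with hf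
  have hfc : ContDiffAt ℝ ∞ f y := by
    have h1 : ContDiffAt ℝ ∞ (fun z : EuclideanSpace ℝ (Fin n) => z - y) y :=
      contDiffAt_id.sub contDiffAt_const
    exact h1.add ((contDiffAt_const.mul (hφy.sub (contDiffAt_const.inner ℝ h1))).smul contDiffAt_const)
  have hfd : HasFDerivAt f ((ContinuousLinearEquiv.refl ℝ (EuclideanSpace ℝ (Fin n)) :
      EuclideanSpace ℝ (Fin n) ≃L[ℝ] EuclideanSpace ℝ (Fin n)) :
      EuclideanSpace ℝ (Fin n) →L[ℝ] EuclideanSpace ℝ (Fin n)) y := by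
    have h1 : HasFDerivAt (fun z : EuclideanSpace ℝ (Fin n) => z - y)
        (ContinuousLinearMap.id ℝ (EuclideanSpace ℝ (Fin n))) y := (hasFDerivAt_id y).sub_const y
    have h2 : HasFDerivAt (fun z : EuclideanSpace ℝ (Fin n) => (inner ℝ a (z - y) : ℝ))
        (innerSL ℝ a) y := by
      have h := (innerSL ℝ a).hasFDerivAt.comp y h1
      rw [ContinuousLinearMap.comp_id] at h
      exact h
    have h3 := (hφy.differentiableAt (by norm_num)).hasFDerivAt
    have hz : fderiv ℝ φ y - innerSL ℝ a = 0 := by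
      ext v
      simp [ha, inner_coordGradient]
    have h4 : HasFDerivAt f _ y := h1.add (((h3.sub h2).const_mul (inner ℝ a a)⁻¹).smul_const a)
    refine h4.congr_fderiv ?_
    rw [hz]
    ext1 v
    simp
  have hfy : f y = 0 := by simp [hf, h0]
  set F₀ := hfc.toOpenPartialHomeomorph f hfd (by norm_num) with hF₀
  have hyF : y ∈ F₀.source := hfc.mem_toOpenPartialHomeomorph_source hfd (by norm_num)
  have hF0y : F₀ y = 0 := hfy
  have ht : (0 : EuclideanSpace ℝ (Fin n)) ∈ (F₀.restrOpen U hU).target := by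
    have := (F₀.restrOpen U hU).map_source (x := y) (by simp [hyF, hy])
    rwa [show (F₀.restrOpen U hU) y = 0 from hfy] at this
  have hsy : (F₀.restrOpen U hU).symm 0 = y := by
    have := (F₀.restrOpen U hU).left_inv (x := y) (by simp [hyF, hy])
    rwa [show (F₀.restrOpen U hU) y = 0 from hfy] at this
  refine ⟨F₀.restrOpen U hU, by simp [hyF, hy], by simp, hfy, fun z => ?_, ?_, ?_⟩
  · change inner ℝ a (f z) = φ z
    simp only [hf]
    rw [inner_add_right, real_inner_smul_right]
    field_simp
    ring
  · exact (F₀.restrOpen U hU).hasFDerivAt_symm (f' := ContinuousLinearEquiv.refl ℝ _) ht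
      (by rw [hsy]; exact hfd)
  · exact (F₀.restrOpen U hU).contDiffAt_symm (f₀' := ContinuousLinearEquiv.refl ℝ _) ht
      (by rw [hsy]; exact hfd) (by rw [hsy]; exact hfc)

/-- In straightened coordinates the line `t • v` lies in the kernel hyperplane. Its image under
`F.symm` is a curve in `S` through `y` with velocity `v`. -/
theorem mem_tangentConeAt_of_fderiv_eq_zero {S U : Set (EuclideanSpace ℝ (Fin n))}
    {φ : EuclideanSpace ℝ (Fin n) → ℝ} (hU : IsOpen U) (hφ : ContDiffOn ℝ ∞ φ U)
    (hSU : S ∩ U = {y ∈ U | φ y = 0}) {y : EuclideanSpace ℝ (Fin n)} (hyS : y ∈ S) (hyU : y ∈ U)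
    (hd : fderiv ℝ φ y ≠ 0) {v : EuclideanSpace ℝ (Fin n)} (hv : fderiv ℝ φ y v = 0) :
    v ∈ tangentConeAt ℝ S y := by
  have h0 : φ y = 0 := (hSU.subset ⟨hyS, hyU⟩).2
  obtain ⟨F, hyF, hFU, hFy, hFφ, hFd, -⟩ := exists_straightening hU hyU hφ hd h0
  have h0t : (0 : EuclideanSpace ℝ (Fin n)) ∈ F.target := hFy ▸ F.map_source hyF
  have hs0 : F.symm 0 = y := by rw [← hFy, F.left_inv hyF]
  have hline : HasFDerivAt (fun t : ℝ => t • v) ((ContinuousLinearMap.id ℝ ℝ).smulRight v) 0 :=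
    (hasFDerivAt_id (0 : ℝ)).smul_const v
  set T : Set ℝ := (fun t : ℝ => t • v) ⁻¹' F.target with hT
  have hTn : T ∈ 𝓝 (0 : ℝ) := by
    have : ContinuousAt (fun t : ℝ => t • v) 0 := by fun_prop
    exact this.preimage_mem_nhds (F.open_target.mem_nhds (by simpa using h0t))
  have hc : HasFDerivAt (fun t : ℝ => F.symm (t • v))
      ((ContinuousLinearMap.id ℝ (EuclideanSpace ℝ (Fin n))).comp
        ((ContinuousLinearMap.id ℝ ℝ).smulRight v)) 0 := by
    refine HasFDerivAt.comp (0 : ℝ) (g := F.symm) (f := fun t : ℝ => t • v) ?_ hline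
    simpa using hFd
  have h1 := (hc.hasFDerivWithinAt (s := T)).mapsTo_tangent_cone
  rw [tangentConeAt_of_mem_nhds hTn] at h1
  have h2 := h1 (mem_univ (1 : ℝ))
  simp only [zero_smul, hs0] at h2
  have h3 := tangentConeAt_mono (𝕜 := ℝ) (x := y) (t := S)
    (s := (fun t : ℝ => F.symm (t • v)) '' T) ?_ h2
  · simpa using h3
  · rintro _ ⟨t, ht, rfl⟩
    have hm : F.symm (t • v) ∈ F.source := F.map_target ht
    refine (hSU.symm.subset ⟨hFU hm, ?_⟩).1
    rw [← hFφ, F.right_inv ht, real_inner_smul_right, inner_coordGradient, hv, mul_zero]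

/-- The component of `ν y` orthogonal to the gradient is a tangent vector, hence also orthogonal to
`ν y`. It is therefore orthogonal to itself and vanishes. -/
theorem normal_eq_smul_coordGradient {S U : Set (EuclideanSpace ℝ (Fin n))}
    {φ : EuclideanSpace ℝ (Fin n) → ℝ} (hU : IsOpen U) (hφ : ContDiffOn ℝ ∞ φ U)
    (hSU : S ∩ U = {y ∈ U | φ y = 0})
    {ν : EuclideanSpace ℝ (Fin n) → EuclideanSpace ℝ (Fin n)} (hν : IsUnitNormalField S ν)
    {y : EuclideanSpace ℝ (Fin n)} (hyS : y ∈ S) (hyU : y ∈ U) (hd : fderiv ℝ φ y ≠ 0) :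
    ν y = (inner ℝ (ν y) (coordGradient φ y) / ‖coordGradient φ y‖ ^ 2) • coordGradient φ y := by
  set a := coordGradient φ y with ha
  have ha0 : ‖a‖ ≠ 0 := norm_ne_zero_iff.2 (coordGradient_ne_zero hd)
  set c : ℝ := inner ℝ (ν y) a / ‖a‖ ^ 2 with hc
  have h1 : inner ℝ a (ν y - c • a) = (0 : ℝ) := by
    rw [inner_sub_right, real_inner_smul_right, real_inner_self_eq_norm_sq, hc,
      real_inner_comm]
    field_simp
    ring
  have h2 : inner ℝ (ν y) (ν y - c • a) = (0 : ℝ) := by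
    refine hν.normal y hyS _ (Submodule.subset_span ?_)
    refine mem_tangentConeAt_of_fderiv_eq_zero hU hφ hSU hyS hyU hd ?_
    rw [← inner_coordGradient]
    exact h1
  have h3 : inner ℝ (ν y - c • a) (ν y - c • a) = (0 : ℝ) := by
    rw [inner_sub_left, h2, real_inner_smul_left, h1]
    simp
  exact sub_eq_zero.1 (inner_self_eq_zero.1 h3)

/-- Near each point of `S`, the unit normal field extends smoothly. -/
theorem exists_smooth_normal_extension {S U : Set (EuclideanSpace ℝ (Fin n))}
    {φ : EuclideanSpace ℝ (Fin n) → ℝ} (hU : IsOpen U) (hφ : ContDiffOn ℝ ∞ φ U)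
    (hSU : S ∩ U = {y ∈ U | φ y = 0})
    {ν : EuclideanSpace ℝ (Fin n) → EuclideanSpace ℝ (Fin n)} (hν : IsUnitNormalField S ν)
    {x : EuclideanSpace ℝ (Fin n)} (hxS : x ∈ S) (hxU : x ∈ U) (hd : fderiv ℝ φ x ≠ 0) :
    ∃ N : EuclideanSpace ℝ (Fin n) → EuclideanSpace ℝ (Fin n), ContDiffAt ℝ ∞ N x ∧
      ∀ᶠ y in 𝓝[S] x, ν y = N y := by
  have hφx : ContDiffAt ℝ ∞ φ x := hφ.contDiffAt (hU.mem_nhds hxU)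
  have hac := contDiffAt_coordGradient hφx
  have hne := coordGradient_ne_zero hd
  -- `σ` is the sign of `ν` relative to the normalized gradient. It is continuous at `x` along `S`
  -- with values `±1`, so it is constant near `x`, and freezing it gives the smooth extension.
  set σ : EuclideanSpace ℝ (Fin n) → ℝ := fun y =>
    inner ℝ (ν y) (‖coordGradient φ y‖⁻¹ • coordGradient φ y) with hσ
  have hfd0 : ∀ᶠ y in 𝓝[S] x, fderiv ℝ φ y ≠ 0 :=
    ((hφx.fderiv_right (m := ∞) (by norm_num)).continuousAt.eventually_ne hd).filter_mono
      nhdsWithin_le_nhds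
  have hUe : ∀ᶠ y in 𝓝[S] x, y ∈ U := mem_nhdsWithin_of_mem_nhds (hU.mem_nhds hxU)
  have hνσ : ∀ y ∈ S, y ∈ U → fderiv ℝ φ y ≠ 0 →
      ν y = σ y • ‖coordGradient φ y‖⁻¹ • coordGradient φ y ∧ |σ y| = 1 := by
    intro y hyS hyU hy
    have h1 : ν y = σ y • ‖coordGradient φ y‖⁻¹ • coordGradient φ y := by
      conv_lhs => rw [normal_eq_smul_coordGradient hU hφ hSU hν hyS hyU hy]
      rw [hσ, smul_smul]
      congr 1
      simp only [real_inner_smul_right]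
      field_simp
    refine ⟨h1, ?_⟩
    have h2 := hν.norm_eq_one y hyS
    rw [h1, norm_smul, norm_smul, norm_inv, norm_norm,
      inv_mul_cancel₀ (norm_ne_zero_iff.2 (coordGradient_ne_zero hy)), mul_one] at h2
    exact h2
  have hσc : ContinuousWithinAt σ S x := by
    refine (hν.continuousOn x hxS).inner ?_
    exact ((hac.continuousAt.norm.inv₀ (norm_ne_zero_iff.2 hne)).smul
      hac.continuousAt).continuousWithinAt
  have hσx := (hνσ x hxS hxU hd).2
  have hclose : ∀ᶠ y in 𝓝[S] x, |σ y - σ x| < 1 := by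
    have := Metric.continuousWithinAt_iff'.1 hσc 1 one_pos
    simpa [Real.dist_eq] using this
  refine ⟨fun y => σ x • ‖coordGradient φ y‖⁻¹ • coordGradient φ y, ?_, ?_⟩
  · exact contDiffAt_const.smul (f := fun _ => σ x) (((hac.norm ℝ hne).inv (norm_ne_zero_iff.2 hne)).smul hac)
  · filter_upwards [hfd0, hUe, hclose, self_mem_nhdsWithin] with y h1 h2 h3 h4
    obtain ⟨h5, h6⟩ := hνσ y h4 h2 h1
    have : σ y = σ x := by
      rw [abs_lt] at h3
      rcases (abs_eq one_pos.le).1 h6 with h | h <;> rcases (abs_eq one_pos.le).1 hσx with h' | h' <;>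
        rw [h, h'] at h3 ⊢ <;> linarith [h3.1, h3.2]
    rw [← this]
    exact h5

end NormalField

/-! ### Normal coordinate charts -/

section Chart

open Filter Topology

variable {n : ℕ}

/-- The component transverse to `e`; the orthogonal projection to `e^⊥` if `e` is a unit vector. -/
noncomputable def transverse (e : EuclideanSpace ℝ (Fin n)) :
    EuclideanSpace ℝ (Fin n) →L[ℝ] EuclideanSpace ℝ (Fin n) :=
  ContinuousLinearMap.id ℝ _ - (innerSL ℝ e).smulRight e

theorem transverse_apply (e ζ : EuclideanSpace ℝ (Fin n)) :
    transverse e ζ = ζ - (inner ℝ e ζ : ℝ) • e := rfl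

theorem transverse_add_smul {e : EuclideanSpace ℝ (Fin n)} (he : ‖e‖ = 1)
    (ζ : EuclideanSpace ℝ (Fin n)) (t : ℝ) : transverse e (ζ + t • e) = transverse e ζ := by
  simp only [transverse_apply, inner_add_right, real_inner_smul_right, real_inner_self_eq_norm_sq,
    he]
  module

theorem inner_transverse {e : EuclideanSpace ℝ (Fin n)} (he : ‖e‖ = 1)
    (ζ : EuclideanSpace ℝ (Fin n)) : inner ℝ e (transverse e ζ) = (0 : ℝ) := by
  simp [transverse_apply, inner_sub_right, real_inner_smul_right, he]

/-- The open cylinder with axis `e`, radius `ρ` and half-height `r`. -/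
def axialCylinder (e : EuclideanSpace ℝ (Fin n)) (ρ r : ℝ) : Set (EuclideanSpace ℝ (Fin n)) :=
  {ζ | ‖transverse e ζ‖ < ρ ∧ |(inner ℝ e ζ : ℝ)| < r}

theorem isOpen_axialCylinder (e : EuclideanSpace ℝ (Fin n)) (ρ r : ℝ) : IsOpen (axialCylinder e ρ r) :=
  (isOpen_lt (f := fun ζ => ‖transverse e ζ‖) (by fun_prop) continuous_const).inter
    (isOpen_lt (f := fun ζ => |(inner ℝ e ζ : ℝ)|) (by fun_prop) continuous_const)

theorem exists_axialCylinder_of_eventually {e : EuclideanSpace ℝ (Fin n)} (he : ‖e‖ = 1)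
    {p : EuclideanSpace ℝ (Fin n) → Prop} (hp : ∀ᶠ ζ in 𝓝 0, p ζ) :
    ∃ ρ : ℝ, 0 < ρ ∧ ∀ ζ ∈ axialCylinder e ρ ρ, p ζ := by
  obtain ⟨δ, hδ, h⟩ := Metric.eventually_nhds_iff.1 hp
  refine ⟨δ / 2, half_pos hδ, fun ζ hζ => h ?_⟩
  have h1 : ζ = transverse e ζ + (inner ℝ e ζ : ℝ) • e := by
    rw [transverse_apply]; module
  rw [dist_zero_right, h1]
  refine (norm_add_le _ _).trans_lt ?_
  rw [norm_smul, he, mul_one, Real.norm_eq_abs]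
  linarith [hζ.1, hζ.2]

/-- A parametrized piece `S ∩ O` of the hypersurface, with normal coordinates. The map `Q` is
constant in the direction `e`, and `ζ ↦ Q ζ + ⟨e, ζ⟩ ν (Q ζ)` is bi-Lipschitz on a cylinder. -/
structure IsShellChart (S : Set (EuclideanSpace ℝ (Fin n)))
    (ν : EuclideanSpace ℝ (Fin n) → EuclideanSpace ℝ (Fin n)) (O : Set (EuclideanSpace ℝ (Fin n)))
    (e : EuclideanSpace ℝ (Fin n)) (ρ L : ℝ)
    (Q Ψ : EuclideanSpace ℝ (Fin n) → EuclideanSpace ℝ (Fin n)) : Prop where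
  isOpen : IsOpen O
  norm_axis : ‖e‖ = 1
  radius_pos : 0 < ρ
  map_eq : ∀ ζ, Ψ ζ = Q ζ + (inner ℝ e ζ : ℝ) • ν (Q ζ)
  base_mem : ∀ ζ ∈ axialCylinder e ρ ρ, Q ζ ∈ S ∩ O
  base_add_smul : ∀ ζ, ∀ t : ℝ, Q (ζ + t • e) = Q ζ
  base_surj : ∀ y ∈ S ∩ O, ∃ ζ ∈ axialCylinder e ρ ρ, Q ζ = y
  base_differentiable : ∀ ζ ∈ axialCylinder e ρ ρ, DifferentiableAt ℝ Q ζ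
  base_bound : ∀ ζ ∈ axialCylinder e ρ ρ, ‖fderiv ℝ Q ζ‖ ≤ L
  differentiable : ∀ ζ ∈ axialCylinder e ρ ρ, DifferentiableAt ℝ Ψ ζ
  bound : ∀ ζ ∈ axialCylinder e ρ ρ, ‖fderiv ℝ Ψ ζ‖ ≤ L
  le_det : ∀ ζ ∈ axialCylinder e ρ ρ, 1 / 2 ≤ |(fderiv ℝ Ψ ζ).det|
  det_le : ∀ ζ ∈ axialCylinder e ρ ρ, |(fderiv ℝ Ψ ζ).det| ≤ 2
  injOn : InjOn Ψ (axialCylinder e ρ ρ)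
  isOpen_image : ∀ V ⊆ axialCylinder e ρ ρ, IsOpen V → IsOpen (Ψ '' V)

/-- `Q` restricts the inverse straightening to the hyperplane orthogonal to `e = ν x`, which
parametrizes `S` near `x`. At the origin `Q` has derivative the projection `transverse e`, and the
normal term restores the direction `e`, so the total derivative is the identity. The inverse
function theorem and continuity give all the bounds on a small cylinder. -/
theorem exists_isShellChart {S : Set (EuclideanSpace ℝ (Fin n))} (hS : IsSmoothHypersurface S)
    {ν : EuclideanSpace ℝ (Fin n) → EuclideanSpace ℝ (Fin n)} (hν : IsUnitNormalField S ν)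
    {x : EuclideanSpace ℝ (Fin n)} (hx : x ∈ S) :
    ∃ O e ρ L Q Ψ, x ∈ O ∧ IsShellChart S ν O e ρ L Q Ψ := by
  obtain ⟨U, φ, hU, hxU, hφ, hd, hSU⟩ := hS x hx
  have h0 : φ x = 0 := (hSU.subset ⟨hx, hxU⟩).2
  obtain ⟨F, hxF, hFU, hFx, hFφ, hFd, hFc⟩ := exists_straightening hU hxU hφ hd h0
  obtain ⟨N, hNc, hNν⟩ := exists_smooth_normal_extension hU hφ hSU hν hx hxU hd
  have hνx := normal_eq_smul_coordGradient hU hφ hSU hν hx hxU hd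
  set a := coordGradient φ x
  set c : ℝ := inner ℝ (ν x) a / ‖a‖ ^ 2
  set e := ν x
  have he : ‖e‖ = 1 := hν.norm_eq_one x hx
  have hc : c ≠ 0 := by
    rintro h
    rw [h, zero_smul] at hνx
    rw [hνx, norm_zero] at he
    exact zero_ne_one he
  have hperp : ∀ v, inner ℝ e v = (0 : ℝ) ↔ inner ℝ a v = (0 : ℝ) := by
    intro v
    rw [hνx, real_inner_smul_left]
    simp [hc]
  have hF0 : F.symm 0 = x := by rw [← hFx, F.left_inv hxF]
  have h0t : (0 : EuclideanSpace ℝ (Fin n)) ∈ F.target := hFx ▸ F.map_source hxF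
  have hFS : ∀ ξ ∈ F.target, inner ℝ e ξ = (0 : ℝ) → F.symm ξ ∈ S := by
    intro ξ hξ h
    refine (hSU.symm.subset ⟨hFU (F.map_target hξ), ?_⟩).1
    rw [← hFφ, F.right_inv hξ]
    exact (hperp ξ).1 h
  set Q : EuclideanSpace ℝ (Fin n) → EuclideanSpace ℝ (Fin n) := fun ζ => F.symm (transverse e ζ)
    with hQ
  have hQ0 : Q 0 = x := by simp [hQ, hF0]
  have hQd0 : HasFDerivAt Q (transverse e) 0 := by
    have h1 : HasFDerivAt F.symm (ContinuousLinearMap.id ℝ (EuclideanSpace ℝ (Fin n)))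
        (transverse e 0) := by simpa using hFd
    exact h1.comp 0 (transverse e).hasFDerivAt
  have hQc : ContDiffAt ℝ 1 Q 0 := by
    have h1 : ContDiffAt ℝ 1 F.symm (transverse e 0) := by
      rw [map_zero]
      exact hFc.of_le (by exact_mod_cast le_top)
    exact h1.comp 0 (transverse e).contDiff.contDiffAt
  -- The extension `N` replaces `ν` so that regularity can be read off; on the final cylinder `Q`
  -- takes values in `S` near `x`, and the two maps agree.
  set Ψ₀ : EuclideanSpace ℝ (Fin n) → EuclideanSpace ℝ (Fin n) := fun ζ =>
    Q ζ + (inner ℝ e ζ : ℝ) • N (Q ζ) with hΨ₀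
  have hNQ : ContDiffAt ℝ 1 (fun ζ => N (Q ζ)) 0 := by
    have h1 : ContDiffAt ℝ 1 N (Q 0) := by
      rw [hQ0]
      exact hNc.of_le (by exact_mod_cast le_top)
    exact h1.comp 0 hQc
  have hΨc : ContDiffAt ℝ 1 Ψ₀ 0 :=
    hQc.add (((innerSL ℝ e).contDiff.contDiffAt (x := 0)).smul hNQ)
  have hNx : N (Q 0) = e := by
    rw [hQ0]
    exact (hNν.self_of_nhdsWithin hx).symm
  have hΨd : HasFDerivAt Ψ₀ ((ContinuousLinearEquiv.refl ℝ (EuclideanSpace ℝ (Fin n)) :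
      EuclideanSpace ℝ (Fin n) ≃L[ℝ] EuclideanSpace ℝ (Fin n)) :
      EuclideanSpace ℝ (Fin n) →L[ℝ] EuclideanSpace ℝ (Fin n)) 0 := by
    have h1 : HasFDerivAt Ψ₀ _ 0 := hQd0.add (((innerSL ℝ e).hasFDerivAt (x := 0)).smul
      (hNQ.differentiableAt one_ne_zero).hasFDerivAt)
    refine h1.congr_fderiv ?_
    ext1 v
    simp [hNx, transverse_apply]
  set H := hΨc.toOpenPartialHomeomorph Ψ₀ hΨd one_ne_zero
  have hH0 : (0 : EuclideanSpace ℝ (Fin n)) ∈ H.source :=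
    hΨc.mem_toOpenPartialHomeomorph_source hΨd one_ne_zero
  have hfd0 : fderiv ℝ Ψ₀ 0 = ContinuousLinearMap.id ℝ (EuclideanSpace ℝ (Fin n)) := hΨd.fderiv
  have hdet0 : |(fderiv ℝ Ψ₀ 0).det| = 1 := by
    rw [hfd0]
    simp [ContinuousLinearMap.det]
  have hΨfc : ContinuousAt (fderiv ℝ Ψ₀) 0 :=
    (hΨc.fderiv_right (m := 0) (by norm_num)).continuousAt
  have hQfc : ContinuousAt (fderiv ℝ Q) 0 :=
    (hQc.fderiv_right (m := 0) (by norm_num)).continuousAt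
  have hdetc : ContinuousAt (fun ζ => |(fderiv ℝ Ψ₀ ζ).det|) 0 :=
    (ContinuousLinearMap.continuous_det.continuousAt.comp hΨfc).abs
  set L := ‖fderiv ℝ Ψ₀ 0‖ + ‖fderiv ℝ Q 0‖ + 1 with hL
  have ev1 : ∀ᶠ ζ in 𝓝 0, ζ ∈ H.source := H.open_source.mem_nhds hH0
  have ev2 : ∀ᶠ ζ in 𝓝 0, DifferentiableAt ℝ Ψ₀ ζ :=
    (hΨc.eventually (by simp)).mono fun ζ h => h.differentiableAt one_ne_zero
  have ev3 : ∀ᶠ ζ in 𝓝 0, DifferentiableAt ℝ Q ζ :=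
    (hQc.eventually (by simp)).mono fun ζ h => h.differentiableAt one_ne_zero
  have ev4 : ∀ᶠ ζ in 𝓝 0, ‖fderiv ℝ Ψ₀ ζ‖ < L :=
    hΨfc.norm.eventually_lt_const (by rw [hL]; linarith [norm_nonneg (fderiv ℝ Q 0)])
  have ev5 : ∀ᶠ ζ in 𝓝 0, ‖fderiv ℝ Q ζ‖ < L :=
    hQfc.norm.eventually_lt_const (by rw [hL]; linarith [norm_nonneg (fderiv ℝ Ψ₀ 0)])
  have ev6 : ∀ᶠ ζ in 𝓝 0, |(fderiv ℝ Ψ₀ ζ).det| < 2 :=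
    hdetc.eventually_lt_const (hdet0.trans_lt one_lt_two)
  have ev7 : ∀ᶠ ζ in 𝓝 0, 1 / 2 < |(fderiv ℝ Ψ₀ ζ).det| :=
    hdetc.eventually_const_lt (lt_of_lt_of_eq one_half_lt_one hdet0.symm)
  have ev8 : ∀ᶠ ζ in 𝓝 0, transverse e ζ ∈ F.target := by
    have : ContinuousAt (transverse e) 0 := by fun_prop
    exact this.preimage_mem_nhds (F.open_target.mem_nhds (by simpa using h0t))
  have ev9 : ∀ᶠ ζ in 𝓝 0, ν (Q ζ) = N (Q ζ) := by
    have : Tendsto Q (𝓝 0) (𝓝[S] x) := by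
      refine tendsto_nhdsWithin_iff.2 ⟨?_, ?_⟩
      · have := hQc.continuousAt.tendsto
        rwa [hQ0] at this
      · filter_upwards [ev8] with ζ hζ
        exact hFS _ hζ (inner_transverse he ζ)
    exact this.eventually hNν
  obtain ⟨ρ, hρ, hev⟩ := exists_axialCylinder_of_eventually he (ev1.and (ev2.and (ev3.and (ev4.and
    (ev5.and (ev6.and (ev7.and (ev8.and ev9))))))))
  set Ψ : EuclideanSpace ℝ (Fin n) → EuclideanSpace ℝ (Fin n) := fun ζ =>
    Q ζ + (inner ℝ e ζ : ℝ) • ν (Q ζ) with hΨ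
  have hEq : EqOn Ψ Ψ₀ (axialCylinder e ρ ρ) := fun ζ hζ => by
    simp only [hΨ, hΨ₀, (hev ζ hζ).2.2.2.2.2.2.2.2]
  have hEqn : ∀ ζ ∈ axialCylinder e ρ ρ, Ψ =ᶠ[𝓝 ζ] Ψ₀ := fun ζ hζ =>
    hEq.eventuallyEq_of_mem ((isOpen_axialCylinder e ρ ρ).mem_nhds hζ)
  have hfdEq : ∀ ζ ∈ axialCylinder e ρ ρ, fderiv ℝ Ψ ζ = fderiv ℝ Ψ₀ ζ := fun ζ hζ =>
    (hEqn ζ hζ).fderiv_eq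
  refine ⟨F.source ∩ F ⁻¹' Metric.ball 0 ρ, e, ρ, L, Q, Ψ, ⟨hxF, by simp [hFx, hρ]⟩, ?_⟩
  refine ⟨F.isOpen_inter_preimage Metric.isOpen_ball, he, hρ, fun _ => rfl, ?_, ?_, ?_, ?_, ?_, ?_,
    ?_, ?_, ?_, ?_, ?_⟩
  · intro ζ hζ
    have ht := (hev ζ hζ).2.2.2.2.2.2.2.1
    refine ⟨hFS _ ht (inner_transverse he ζ), F.map_target ht, ?_⟩
    rw [mem_preimage, hQ, F.right_inv ht, mem_ball_zero_iff]
    exact hζ.1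
  · intro ζ t
    simp only [hQ, transverse_add_smul he]
  · rintro y ⟨hyS, hyF, hyρ⟩
    have h1 : inner ℝ e (F y) = (0 : ℝ) := by
      rw [hperp, hFφ]
      exact (hSU.subset ⟨hyS, hFU hyF⟩).2
    have h2 : transverse e (F y) = F y := by simp [transverse_apply, h1]
    refine ⟨F y, ⟨?_, ?_⟩, ?_⟩
    · rw [h2]; simpa using hyρ
    · rw [h1, abs_zero]; exact hρ
    · simp only [hQ, h2, F.left_inv hyF]
  · exact fun ζ hζ => (hev ζ hζ).2.2.1
  · exact fun ζ hζ => (hev ζ hζ).2.2.2.2.1.le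
  · exact fun ζ hζ => (hEqn ζ hζ).differentiableAt_iff.2 (hev ζ hζ).2.1
  · exact fun ζ hζ => hfdEq ζ hζ ▸ (hev ζ hζ).2.2.2.1.le
  · exact fun ζ hζ => hfdEq ζ hζ ▸ (hev ζ hζ).2.2.2.2.2.2.1.le
  · exact fun ζ hζ => hfdEq ζ hζ ▸ (hev ζ hζ).2.2.2.2.2.1.le
  · exact (H.injOn.mono fun ζ hζ => (hev ζ hζ).1).congr hEq.symm
  · intro V hV hVo
    rw [(hEq.mono hV).image_eq]
    exact H.isOpen_image_of_subset_source hVo fun ζ hζ => (hev ζ (hV hζ)).1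

end Chart

/-! ### Parametrizing the shell by a cylinder of fixed size -/

section ShellMap

open Filter Topology

variable {n : ℕ}

theorem convex_axialCylinder (e : EuclideanSpace ℝ (Fin n)) (ρ r : ℝ) :
    Convex ℝ (axialCylinder e ρ r) := by
  have h1 : Convex ℝ (transverse e ⁻¹' Metric.ball 0 ρ) :=
    (convex_ball 0 ρ).linear_preimage (transverse e).toLinearMap
  have h2 : Convex ℝ (innerSL ℝ e ⁻¹' Metric.ball 0 r) :=
    (convex_ball 0 r).linear_preimage (innerSL ℝ e).toLinearMap
  convert h1.inter h2 using 1
  ext ζ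
  simp [axialCylinder]

theorem norm_lt_of_mem_axialCylinder {e : EuclideanSpace ℝ (Fin n)} (he : ‖e‖ = 1) {ρ r : ℝ}
    {ζ : EuclideanSpace ℝ (Fin n)} (hζ : ζ ∈ axialCylinder e ρ r) : ‖ζ‖ < ρ + r := by
  have h1 : ζ = transverse e ζ + (inner ℝ e ζ : ℝ) • e := by
    rw [transverse_apply]; module
  rw [h1]
  refine (norm_add_le _ _).trans_lt ?_
  rw [norm_smul, he, mul_one, Real.norm_eq_abs]
  exact add_lt_add hζ.1 hζ.2

theorem norm_transverse_le {e : EuclideanSpace ℝ (Fin n)} (he : ‖e‖ = 1) : ‖transverse e‖ ≤ 2 := by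
  refine (norm_sub_le _ _).trans ?_
  have h1 : ‖ContinuousLinearMap.id ℝ (EuclideanSpace ℝ (Fin n))‖ ≤ 1 :=
    ContinuousLinearMap.norm_id_le
  rw [ContinuousLinearMap.norm_smulRight_apply, innerSL_apply_norm, he]
  linarith

theorem transverse_self {e : EuclideanSpace ℝ (Fin n)} (he : ‖e‖ = 1) : transverse e e = 0 := by
  simp [transverse_apply, he]

/-- At height `h`: `C₁ h ≤ b ≤ C₂ h` and `|∇b| ≤ C₃ h` on `S`. -/
def HeightBounds (S : Set (EuclideanSpace ℝ (Fin n))) (b : EuclideanSpace ℝ (Fin n) → ℝ)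
    (C₁ C₂ C₃ h : ℝ) : Prop :=
  ∀ x ∈ S, C₁ * h ≤ b x ∧ b x ≤ C₂ * h ∧ ∃ w, IsSurfaceGradientAt S b x w ∧ ‖w‖ ≤ C₃ * h

/-- The parametrization of the shell over a chart by a cylinder of half-height one. -/
noncomputable def shellMap (e : EuclideanSpace ℝ (Fin n))
    (Q Ψ : EuclideanSpace ℝ (Fin n) → EuclideanSpace ℝ (Fin n))
    (b₁ b₂ : EuclideanSpace ℝ (Fin n) → ℝ) (ζ : EuclideanSpace ℝ (Fin n)) :
    EuclideanSpace ℝ (Fin n) :=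
  Ψ (ζ + ((b₂ (Q ζ) - b₁ (Q ζ)) / 2 +
    (inner ℝ e ζ : ℝ) * ((b₁ (Q ζ) + b₂ (Q ζ)) / 2 - 1)) • e)

variable {S O : Set (EuclideanSpace ℝ (Fin n))}
  {ν Q Ψ : EuclideanSpace ℝ (Fin n) → EuclideanSpace ℝ (Fin n)} {e : EuclideanSpace ℝ (Fin n)}
  {ρ L : ℝ}

namespace IsShellChart

theorem base_transverse (hc : IsShellChart S ν O e ρ L Q Ψ) (ζ : EuclideanSpace ℝ (Fin n)) :
    Q (transverse e ζ) = Q ζ := by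
  rw [← hc.base_add_smul (transverse e ζ) (inner ℝ e ζ), transverse_apply]
  congr 1
  module

theorem transverse_mem (hc : IsShellChart S ν O e ρ L Q Ψ) {ζ : EuclideanSpace ℝ (Fin n)}
    (hζ : ‖transverse e ζ‖ < ρ) : transverse e ζ ∈ axialCylinder e ρ ρ := by
  refine ⟨?_, ?_⟩
  · have : transverse e (transverse e ζ) = transverse e ζ := by
      rw [transverse_apply e (transverse e ζ), inner_transverse hc.norm_axis, zero_smul, sub_zero]
    rwa [this]
  · rw [inner_transverse hc.norm_axis, abs_zero]
    exact hc.radius_pos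

theorem base_mem' (hc : IsShellChart S ν O e ρ L Q Ψ) {ζ : EuclideanSpace ℝ (Fin n)}
    (hζ : ‖transverse e ζ‖ < ρ) : Q ζ ∈ S ∩ O :=
  hc.base_transverse ζ ▸ hc.base_mem _ (hc.transverse_mem hζ)

theorem bound_nonneg (hc : IsShellChart S ν O e ρ L Q Ψ) : 0 ≤ L := by
  have h0 : (0 : EuclideanSpace ℝ (Fin n)) ∈ axialCylinder e ρ ρ := by
    simp [axialCylinder, hc.radius_pos]
  exact (norm_nonneg _).trans (hc.bound 0 h0)

theorem hasFDerivAt_base (hc : IsShellChart S ν O e ρ L Q Ψ) {ζ : EuclideanSpace ℝ (Fin n)}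
    (hζ : ‖transverse e ζ‖ < ρ) :
    HasFDerivAt Q ((fderiv ℝ Q (transverse e ζ)).comp (transverse e)) ζ := by
  have h1 := ((hc.base_differentiable _ (hc.transverse_mem hζ)).hasFDerivAt).comp ζ
    (transverse e).hasFDerivAt
  refine h1.congr_of_eventuallyEq (Eventually.of_forall fun ξ => ?_)
  exact (hc.base_transverse ξ).symm

/-- A height function in chart coordinates. -/
theorem exists_hasFDerivAt_height (hc : IsShellChart S ν O e ρ L Q Ψ)
    {b : EuclideanSpace ℝ (Fin n) → ℝ} {C₁ C₂ C₃ h : ℝ} (hb : HeightBounds S b C₁ C₂ C₃ h)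
    {ζ : EuclideanSpace ℝ (Fin n)} (hζ : ‖transverse e ζ‖ < ρ) :
    ∃ β : EuclideanSpace ℝ (Fin n) →L[ℝ] ℝ, HasFDerivAt (fun ξ => b (Q ξ)) β ζ ∧
      ‖β‖ ≤ C₃ * h * (L * 2) ∧ β e = 0 := by
  obtain ⟨-, -, w, hw, hwn⟩ := hb (Q ζ) (hc.base_mem' hζ).1
  have hD : IsOpen {ξ : EuclideanSpace ℝ (Fin n) | ‖transverse e ξ‖ < ρ} :=
    isOpen_lt (by fun_prop) continuous_const
  have h1 := (hasGradientWithinAt_iff_hasFDerivWithinAt.1 hw.2).comp ζ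
    (hc.hasFDerivAt_base hζ).hasFDerivWithinAt
    (s := {ξ | ‖transverse e ξ‖ < ρ}) fun ξ hξ => (hc.base_mem' hξ).1
  refine ⟨_, h1.hasFDerivAt (hD.mem_nhds hζ), ?_, ?_⟩
  · refine (ContinuousLinearMap.opNorm_comp_le _ _).trans ?_
    refine mul_le_mul (by simpa using hwn) ?_ (norm_nonneg _) ((norm_nonneg _).trans hwn)
    refine (ContinuousLinearMap.opNorm_comp_le _ _).trans ?_
    exact mul_le_mul (hc.base_bound _ (hc.transverse_mem hζ)) (norm_transverse_le hc.norm_axis)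
      (norm_nonneg _) hc.bound_nonneg
  · simp [transverse_self hc.norm_axis]

variable {b₁ b₂ : EuclideanSpace ℝ (Fin n) → ℝ} {C₁ C₂ C₃ h : ℝ}

theorem shellMap_eq (hc : IsShellChart S ν O e ρ L Q Ψ) (ζ : EuclideanSpace ℝ (Fin n)) :
    shellMap e Q Ψ b₁ b₂ ζ = Q ζ + ((b₂ (Q ζ) - b₁ (Q ζ)) / 2 +
      (inner ℝ e ζ : ℝ) * ((b₁ (Q ζ) + b₂ (Q ζ)) / 2)) • ν (Q ζ) := by
  rw [shellMap, hc.map_eq, hc.base_add_smul, inner_add_right, real_inner_smul_right,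
    real_inner_self_eq_norm_sq, hc.norm_axis]
  congr 2
  ring

/-- The stretching in the axial direction maps the cylinder of half-height one to the domain
of the chart. -/
theorem stretch_mem (hc : IsShellChart S ν O e ρ L Q Ψ) (hC₁ : 0 < C₁) (hh : 0 < h)
    (hhρ : C₂ * h ≤ ρ) (hb₁ : HeightBounds S b₁ C₁ C₂ C₃ h) (hb₂ : HeightBounds S b₂ C₁ C₂ C₃ h)
    {ζ : EuclideanSpace ℝ (Fin n)} (hζ : ζ ∈ axialCylinder e ρ 1) :
    ζ + ((b₂ (Q ζ) - b₁ (Q ζ)) / 2 + (inner ℝ e ζ : ℝ) * ((b₁ (Q ζ) + b₂ (Q ζ)) / 2 - 1)) • e ∈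
      axialCylinder e ρ ρ := by
  obtain ⟨h1, h2, -⟩ := hb₁ _ (hc.base_mem' hζ.1).1
  obtain ⟨h3, h4, -⟩ := hb₂ _ (hc.base_mem' hζ.1).1
  have h5 : 0 < C₁ * h := by positivity
  refine ⟨by rw [transverse_add_smul hc.norm_axis]; exact hζ.1, ?_⟩
  rw [inner_add_right, real_inner_smul_right, real_inner_self_eq_norm_sq, hc.norm_axis]
  have h6 := abs_lt.1 hζ.2
  rw [abs_lt]
  constructor <;> nlinarith

/-- The map is `Ψ` after an axial stretch by the mean height `d`. The chart controls `Ψ`; the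
stretch has determinant `d`, which lies between `C₁ * h` and `C₂ * h`. The height gradients enter
the norm but not the determinant, and `h ≤ 1` makes the norm bound free of `h`. -/
theorem exists_hasFDerivAt_shellMap (hc : IsShellChart S ν O e ρ L Q Ψ) (hC₁ : 0 < C₁)
    (hh : 0 < h) (hh1 : h ≤ 1) (hhρ : C₂ * h ≤ ρ) (hb₁ : HeightBounds S b₁ C₁ C₂ C₃ h)
    (hb₂ : HeightBounds S b₂ C₁ C₂ C₃ h)
    {ζ : EuclideanSpace ℝ (Fin n)} (hζ : ζ ∈ axialCylinder e ρ 1) :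
    ∃ Φ' : EuclideanSpace ℝ (Fin n) →L[ℝ] EuclideanSpace ℝ (Fin n),
      HasFDerivAt (shellMap e Q Ψ b₁ b₂) Φ' ζ ∧ ‖Φ'‖ ≤ L * (2 + 4 * L * C₃ + C₂) ∧
      C₁ * h / 2 ≤ |Φ'.det| ∧ |Φ'.det| ≤ 2 * (C₂ * h) := by
  obtain ⟨h1, h2, w, -, hw⟩ := hb₁ _ (hc.base_mem' hζ.1).1
  obtain ⟨h3, h4, -⟩ := hb₂ _ (hc.base_mem' hζ.1).1
  obtain ⟨β₁, hβ₁, hβ₁n, hβ₁e⟩ := hc.exists_hasFDerivAt_height hb₁ hζ.1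
  obtain ⟨β₂, hβ₂, hβ₂n, hβ₂e⟩ := hc.exists_hasFDerivAt_height hb₂ hζ.1
  have hs := hζ.2
  have hmem := hc.stretch_mem hC₁ hh hhρ hb₁ hb₂ hζ
  have hL := hc.bound_nonneg
  set s : ℝ := inner ℝ e ζ
  set d : ℝ := (b₁ (Q ζ) + b₂ (Q ζ)) / 2 with hd
  set ℓ : EuclideanSpace ℝ (Fin n) →L[ℝ] ℝ := (2 : ℝ)⁻¹ • (β₂ - β₁) +
    (s • ((2 : ℝ)⁻¹ • (β₁ + β₂)) + (d - 1) • innerSL ℝ e) with hℓ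
  set A : EuclideanSpace ℝ (Fin n) → EuclideanSpace ℝ (Fin n) := fun ζ =>
    ζ + ((b₂ (Q ζ) - b₁ (Q ζ)) / 2 +
      (inner ℝ e ζ : ℝ) * ((b₁ (Q ζ) + b₂ (Q ζ)) / 2 - 1)) • e with hA
  set A' : EuclideanSpace ℝ (Fin n) →L[ℝ] EuclideanSpace ℝ (Fin n) :=
    ContinuousLinearMap.id ℝ _ + ℓ.smulRight e with hA'
  have hAd : HasFDerivAt A A' ζ := by
    refine (hasFDerivAt_id ζ).add (HasFDerivAt.smul_const ?_ e)
    have e1 : HasFDerivAt (fun ξ => (b₂ (Q ξ) - b₁ (Q ξ)) / 2) ((2 : ℝ)⁻¹ • (β₂ - β₁)) ζ := by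
      simp_rw [div_eq_inv_mul]
      exact (hβ₂.sub hβ₁).const_mul _
    have e2 : HasFDerivAt (fun ξ => (b₁ (Q ξ) + b₂ (Q ξ)) / 2 - 1) ((2 : ℝ)⁻¹ • (β₁ + β₂)) ζ := by
      simp_rw [div_eq_inv_mul]
      exact ((hβ₁.add hβ₂).const_mul _).sub_const 1
    exact e1.add ((innerSL ℝ e).hasFDerivAt.mul e2)
  -- `A'` is a rank-one perturbation of the identity, with determinant `1 + ℓ e`. The height
  -- derivatives kill `e`, so only `d - 1` remains in `ℓ e`.
  have hdet : A'.det = d := by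
    have : (A' : EuclideanSpace ℝ (Fin n) →ₗ[ℝ] EuclideanSpace ℝ (Fin n)) =
        LinearMap.transvection (ℓ : EuclideanSpace ℝ (Fin n) →ₗ[ℝ] ℝ) e := by
      ext1 v
      simp [hA', LinearMap.transvection.apply]
    rw [ContinuousLinearMap.det, this, LinearMap.transvection.det]
    simp [hℓ, hβ₁e, hβ₂e, hc.norm_axis]
  have hC3 : 0 ≤ C₃ * h := (norm_nonneg w).trans hw
  have hC3' : C₃ * h ≤ C₃ := by nlinarith
  have hC1 : 0 < C₁ * h := by positivity
  have hC20 : 0 < C₂ := (pos_iff_pos_of_mul_pos (show 0 < C₂ * h by linarith)).2 hh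
  have hC2 : C₂ * h ≤ C₂ := by nlinarith
  have hA'n : ‖A'‖ ≤ 2 + 4 * L * C₃ + C₂ := by
    have n1 : ‖(2 : ℝ)⁻¹ • (β₂ - β₁)‖ ≤ C₃ * h * (L * 2) := by
      rw [norm_smul]
      have := norm_sub_le β₂ β₁
      norm_num
      linarith
    have n2 : ‖s • ((2 : ℝ)⁻¹ • (β₁ + β₂))‖ ≤ 1 * (C₃ * h * (L * 2)) := by
      rw [norm_smul]
      refine mul_le_mul hs.le ?_ (norm_nonneg _) zero_le_one
      rw [norm_smul]
      have := norm_add_le β₁ β₂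
      norm_num
      linarith
    have n3 : ‖(d - 1) • innerSL ℝ e‖ ≤ C₂ + 1 := by
      rw [norm_smul, innerSL_apply_norm, hc.norm_axis, mul_one, Real.norm_eq_abs, abs_le, hd]
      constructor <;> linarith
    have n4 : C₃ * h * (L * 2) ≤ C₃ * (L * 2) := by gcongr
    have n5 : ‖ℓ‖ ≤ 4 * L * C₃ + C₂ + 1 := by
      refine (norm_add_le _ _).trans ?_
      have := norm_add_le (s • ((2 : ℝ)⁻¹ • (β₁ + β₂))) ((d - 1) • innerSL ℝ e)
      linarith
    refine (norm_add_le _ _).trans ?_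
    rw [ContinuousLinearMap.norm_smulRight_apply, hc.norm_axis, mul_one]
    have := ContinuousLinearMap.norm_id_le (𝕜 := ℝ) (E := EuclideanSpace ℝ (Fin n))
    linarith
  have hΨ := (hc.differentiable _ hmem).hasFDerivAt
  have hd1 := hc.le_det _ hmem
  have hd2 := hc.det_le _ hmem
  have hdetc : ((fderiv ℝ Ψ (A ζ)).comp A').det = (fderiv ℝ Ψ (A ζ)).det * A'.det := by
    simp [ContinuousLinearMap.det, LinearMap.det_comp]
  refine ⟨(fderiv ℝ Ψ (A ζ)).comp A', hΨ.comp ζ hAd, ?_, ?_, ?_⟩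
  · refine (ContinuousLinearMap.opNorm_comp_le _ _).trans ?_
    exact mul_le_mul (hc.bound _ hmem) hA'n (norm_nonneg _) hL
  · rw [hdetc, hdet, abs_mul, abs_of_pos (show 0 < d by rw [hd]; linarith)]
    have : C₁ * h ≤ d := by rw [hd]; linarith
    calc C₁ * h / 2 = 1 / 2 * (C₁ * h) := by ring
      _ ≤ _ := mul_le_mul hd1 this hC1.le (abs_nonneg _)
  · have hd0 : 0 < d := by rw [hd]; linarith
    rw [hdetc, hdet, abs_mul, abs_of_pos hd0]
    have : d ≤ C₂ * h := by rw [hd]; linarith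
    exact mul_le_mul hd2 this hd0.le (by norm_num)

theorem injOn_shellMap (hc : IsShellChart S ν O e ρ L Q Ψ) (hC₁ : 0 < C₁) (hh : 0 < h)
    (hhρ : C₂ * h ≤ ρ) (hb₁ : HeightBounds S b₁ C₁ C₂ C₃ h)
    (hb₂ : HeightBounds S b₂ C₁ C₂ C₃ h) :
    InjOn (shellMap e Q Ψ b₁ b₂) (axialCylinder e ρ 1) := by
  intro ζ hζ ξ hξ hEq
  have h1 := hc.injOn (hc.stretch_mem hC₁ hh hhρ hb₁ hb₂ hζ) (hc.stretch_mem hC₁ hh hhρ hb₁ hb₂ hξ)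
    hEq
  have h2 := congrArg (transverse e) h1
  rw [transverse_add_smul hc.norm_axis, transverse_add_smul hc.norm_axis] at h2
  have hQ : Q ζ = Q ξ := by rw [← hc.base_transverse ζ, h2, hc.base_transverse]
  have h3 := congrArg (fun v => (inner ℝ e v : ℝ)) h1
  simp only [inner_add_right, real_inner_smul_right, real_inner_self_eq_norm_sq, hc.norm_axis,
    hQ] at h3
  have h4 := (hb₁ _ (hc.base_mem' hξ.1).1).1
  have h5 := (hb₂ _ (hc.base_mem' hξ.1).1).1
  have h6 : 0 < C₁ * h := by positivity
  have h7 : (inner ℝ e ζ - inner ℝ e ξ : ℝ) * ((b₁ (Q ξ) + b₂ (Q ξ)) / 2) = 0 := by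
    linear_combination h3
  have h8 : (inner ℝ e ζ : ℝ) = inner ℝ e ξ := by
    rcases mul_eq_zero.1 h7 with h8 | h8 <;> linarith
  rw [transverse_apply, transverse_apply, h8] at h2
  exact sub_left_injective h2

theorem image_shellMap (hc : IsShellChart S ν O e ρ L Q Ψ) (hC₁ : 0 < C₁) (hh : 0 < h)
    (hb₁ : HeightBounds S b₁ C₁ C₂ C₃ h) (hb₂ : HeightBounds S b₂ C₁ C₂ C₃ h) :
    shellMap e Q Ψ b₁ b₂ '' axialCylinder e ρ 1 = thinShell (S ∩ O) ν b₁ b₂ := by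
  have h6 : 0 < C₁ * h := by positivity
  ext z
  constructor
  · rintro ⟨ζ, hζ, rfl⟩
    have hm := hc.base_mem' hζ.1
    have h4 := (hb₁ _ hm.1).1
    have h5 := (hb₂ _ hm.1).1
    have h7 := abs_lt.1 hζ.2
    refine ⟨Q ζ, hm, _, ?_, ?_, hc.shellMap_eq ζ⟩ <;> nlinarith
  · rintro ⟨y, hy, t, ht1, ht2, rfl⟩
    obtain ⟨ξ, hξ, rfl⟩ := hc.base_surj y hy
    have h4 := (hb₁ _ hy.1).1
    have h5 := (hb₂ _ hy.1).1
    have h7 : 0 < b₁ (Q ξ) + b₂ (Q ξ) := by linarith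
    set s : ℝ := (t - (b₂ (Q ξ) - b₁ (Q ξ)) / 2) / ((b₁ (Q ξ) + b₂ (Q ξ)) / 2) with hs
    have hin : (inner ℝ e (transverse e ξ + s • e) : ℝ) = s := by
      rw [inner_add_right, inner_transverse hc.norm_axis, real_inner_smul_right,
        real_inner_self_eq_norm_sq, hc.norm_axis]
      ring
    refine ⟨transverse e ξ + s • e, ⟨?_, ?_⟩, ?_⟩
    · rw [transverse_add_smul hc.norm_axis]
      exact (hc.transverse_mem hξ.1).1
    · rw [hin, abs_lt, hs, lt_div_iff₀ (by linarith), div_lt_iff₀ (by linarith)]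
      constructor <;> linarith
    · rw [hc.shellMap_eq, hc.base_add_smul, hc.base_transverse, hin]
      congr 2
      rw [hs]
      field_simp
      ring

/-- The piece is the `Ψ`-image of the region between the graphs of `-b₁ ∘ Q` and `b₂ ∘ Q`, which is
open because the heights are continuous in the chart. -/
theorem isOpen_shell (hc : IsShellChart S ν O e ρ L Q Ψ)
    (hhρ : C₂ * h ≤ ρ) (hb₁ : HeightBounds S b₁ C₁ C₂ C₃ h)
    (hb₂ : HeightBounds S b₂ C₁ C₂ C₃ h) : IsOpen (thinShell (S ∩ O) ν b₁ b₂) := by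
  set D : Set (EuclideanSpace ℝ (Fin n)) := {ζ | ‖transverse e ζ‖ < ρ} with hDdef
  have hD : IsOpen D := isOpen_lt (by fun_prop) continuous_const
  have hcont : ∀ {b : EuclideanSpace ℝ (Fin n) → ℝ}, HeightBounds S b C₁ C₂ C₃ h →
      ContinuousOn (fun ζ => b (Q ζ)) D := by
    intro b hb ζ hζ
    obtain ⟨β, hβ, -⟩ := hc.exists_hasFDerivAt_height hb hζ
    exact hβ.continuousAt.continuousWithinAt
  have hinn : Continuous fun ζ : EuclideanSpace ℝ (Fin n) => (inner ℝ e ζ : ℝ) := by fun_prop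
  set V : Set (EuclideanSpace ℝ (Fin n)) :=
    D ∩ (fun ζ => ((inner ℝ e ζ : ℝ) + b₁ (Q ζ), b₂ (Q ζ) - inner ℝ e ζ)) ⁻¹'
      (Ioi 0 ×ˢ Ioi 0) with hV
  have hVo : IsOpen V :=
    ((hinn.continuousOn.add (hcont hb₁)).prodMk
      ((hcont hb₂).sub hinn.continuousOn)).isOpen_inter_preimage hD (isOpen_Ioi.prod isOpen_Ioi)
  have hVD : V ⊆ axialCylinder e ρ ρ := by
    rintro ζ ⟨hζ, h1, h2⟩
    obtain ⟨-, h3, -⟩ := hb₁ _ (hc.base_mem' hζ).1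
    obtain ⟨-, h4, -⟩ := hb₂ _ (hc.base_mem' hζ).1
    simp only [mem_Ioi] at h1 h2
    exact ⟨hζ, abs_lt.2 ⟨by linarith, by linarith⟩⟩
  convert hc.isOpen_image V hVD hVo using 1
  ext z
  constructor
  · rintro ⟨y, hy, t, ht1, ht2, rfl⟩
    obtain ⟨ξ, hξ, rfl⟩ := hc.base_surj y hy
    have hin : (inner ℝ e (transverse e ξ + t • e) : ℝ) = t := by
      rw [inner_add_right, inner_transverse hc.norm_axis, real_inner_smul_right,
        real_inner_self_eq_norm_sq, hc.norm_axis]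
      ring
    have hQ : Q (transverse e ξ + t • e) = Q ξ := by rw [hc.base_add_smul, hc.base_transverse]
    refine ⟨transverse e ξ + t • e, ⟨?_, ?_⟩, ?_⟩
    · rw [hDdef, mem_ofPred_eq, transverse_add_smul hc.norm_axis]
      exact (hc.transverse_mem hξ.1).1
    · simp only [mem_preimage, mem_prod, mem_Ioi, hin, hQ]
      constructor <;> linarith
    · rw [hc.map_eq, hin, hQ]
  · rintro ⟨ζ, ⟨hζ, h1, h2⟩, rfl⟩
    simp only [mem_Ioi] at h1 h2
    exact ⟨Q ζ, hc.base_mem' hζ, inner ℝ e ζ, by linarith, by linarith, hc.map_eq ζ⟩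

end IsShellChart

end ShellMap

/-! ### Poincaré inequality and volume overlap in one chart -/

section ShellPoincare

open Filter Topology

variable {n : ℕ} {S O : Set (EuclideanSpace ℝ (Fin n))}
  {ν Q Ψ : EuclideanSpace ℝ (Fin n) → EuclideanSpace ℝ (Fin n)} {e : EuclideanSpace ℝ (Fin n)}
  {ρ L : ℝ} {b₁ b₂ : EuclideanSpace ℝ (Fin n) → ℝ} {C₁ C₂ C₃ h : ℝ}

theorem volume_axialCylinder_ne_top {e : EuclideanSpace ℝ (Fin n)} (he : ‖e‖ = 1) (ρ r : ℝ) :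
    volume (axialCylinder e ρ r) ≠ ⊤ := by
  refine ((measure_mono (t := Metric.ball 0 (ρ + r)) fun ζ hζ => ?_).trans_lt measure_ball_lt_top).ne
  rw [mem_ball_zero_iff]
  exact norm_lt_of_mem_axialCylinder he hζ

theorem volume_axialCylinder_ne_zero {e : EuclideanSpace ℝ (Fin n)} {ρ r : ℝ}
    (hρ : 0 < ρ) (hr : 0 < r) : volume (axialCylinder e ρ r) ≠ 0 :=
  ((isOpen_axialCylinder e ρ r).measure_pos volume ⟨0, by simp [axialCylinder, hρ, hr]⟩).ne'

theorem axialCylinder_mono (e : EuclideanSpace ℝ (Fin n)) {ρ ρ' r r' : ℝ} (hρ : ρ ≤ ρ')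
    (hr : r ≤ r') : axialCylinder e ρ r ⊆ axialCylinder e ρ' r' :=
  fun _ hζ => ⟨hζ.1.trans_le hρ, hζ.2.trans_le hr⟩

theorem isCompact_closed_axialCylinder {e : EuclideanSpace ℝ (Fin n)} (he : ‖e‖ = 1) (ρ r : ℝ) :
    IsCompact {ζ | ‖transverse e ζ‖ ≤ ρ ∧ |(inner ℝ e ζ : ℝ)| ≤ r} := by
  refine Metric.isCompact_of_isClosed_isBounded ?_ ?_
  · exact (isClosed_le (f := fun ζ => ‖transverse e ζ‖) (by fun_prop) continuous_const).inter
      (isClosed_le (f := fun ζ => |(inner ℝ e ζ : ℝ)|) (by fun_prop) continuous_const)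
  · refine (Metric.isBounded_ball (x := (0 : EuclideanSpace ℝ (Fin n)))
      (r := (ρ + 1) + (r + 1))).subset fun ζ hζ => ?_
    rw [mem_ball_zero_iff]
    exact norm_lt_of_mem_axialCylinder he ⟨by linarith [hζ.1], by linarith [hζ.2]⟩

namespace IsShellChart

theorem setLIntegral_image_le (hc : IsShellChart S ν O e ρ L Q Ψ) (hC₁ : 0 < C₁)
    (hh : 0 < h) (hh1 : h ≤ 1) (hhρ : C₂ * h ≤ ρ) (hb₁ : HeightBounds S b₁ C₁ C₂ C₃ h)
    (hb₂ : HeightBounds S b₂ C₁ C₂ C₃ h) {B : Set (EuclideanSpace ℝ (Fin n))}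
    (hB : B ⊆ axialCylinder e ρ 1) (hBm : MeasurableSet B) :
    MeasurableSet (shellMap e Q Ψ b₁ b₂ '' B) ∧
    ∀ φ : EuclideanSpace ℝ (Fin n) → ℝ≥0∞,
      (∫⁻ z in shellMap e Q Ψ b₁ b₂ '' B, φ z ≤
        ENNReal.ofReal (2 * (C₂ * h)) * ∫⁻ ζ in B, φ (shellMap e Q Ψ b₁ b₂ ζ)) ∧
      (ENNReal.ofReal (C₁ * h / 2) * ∫⁻ ζ in B, φ (shellMap e Q Ψ b₁ b₂ ζ) ≤
        ∫⁻ z in shellMap e Q Ψ b₁ b₂ '' B, φ z) := by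
  have hd := fun ζ (hζ : ζ ∈ B) =>
    hc.exists_hasFDerivAt_shellMap hC₁ hh hh1 hhρ hb₁ hb₂ (hB hζ)
  choose! Φ' h1 h2 h3 h4 using hd
  have hinj := (hc.injOn_shellMap hC₁ hh hhρ hb₁ hb₂).mono hB
  have hw : ∀ ζ ∈ B, HasFDerivWithinAt (shellMap e Q Ψ b₁ b₂) (Φ' ζ) B ζ := fun ζ hζ =>
    (h1 ζ hζ).hasFDerivWithinAt
  refine ⟨measurable_image_of_fderivWithin hBm hw hinj, fun φ => ?_⟩
  rw [lintegral_image_eq_lintegral_abs_det_fderiv_mul volume hBm hw hinj]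
  constructor
  · rw [← lintegral_const_mul' _ _ ENNReal.ofReal_ne_top]
    refine setLIntegral_mono' hBm fun ζ hζ => ?_
    gcongr
    exact h4 ζ hζ
  · rw [← lintegral_const_mul' _ _ ENNReal.ofReal_ne_top]
    refine setLIntegral_mono' hBm fun ζ hζ => ?_
    gcongr
    exact h3 ζ hζ

theorem volume_image_le (hc : IsShellChart S ν O e ρ L Q Ψ) (hC₁ : 0 < C₁)
    (hh : 0 < h) (hh1 : h ≤ 1) (hhρ : C₂ * h ≤ ρ) (hb₁ : HeightBounds S b₁ C₁ C₂ C₃ h)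
    (hb₂ : HeightBounds S b₂ C₁ C₂ C₃ h) {B : Set (EuclideanSpace ℝ (Fin n))}
    (hB : B ⊆ axialCylinder e ρ 1) (hBm : MeasurableSet B) :
    volume (shellMap e Q Ψ b₁ b₂ '' B) ≤ ENNReal.ofReal (2 * (C₂ * h)) * volume B ∧
    ENNReal.ofReal (C₁ * h / 2) * volume B ≤ volume (shellMap e Q Ψ b₁ b₂ '' B) := by
  have := (hc.setLIntegral_image_le hC₁ hh hh1 hhρ hb₁ hb₂ hB hBm).2 (fun _ => 1)
  simpa using this

/-- The constant in the pairwise Poincaré inequality of a chart. -/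
noncomputable def _root_.chartConst (n : ℕ) (ρ L C₂ C₃ : ℝ) : ℝ :=
  (L * (2 + 4 * L * C₃ + C₂) * (2 * (ρ + 1))) ^ 2 * 2 ^ (n + 1)

/-- Pulling back the double integral costs the upper Jacobian bound twice, pushing the gradient
integral forward costs the lower bound once. The latter stays on the left so that no division
occurs. -/
theorem poincare_smooth (hc : IsShellChart S ν O e ρ L Q Ψ) (hC₁ : 0 < C₁)
    (hh : 0 < h) (hh1 : h ≤ 1) (hhρ : C₂ * h ≤ ρ) (hb₁ : HeightBounds S b₁ C₁ C₂ C₃ h)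
    (hb₂ : HeightBounds S b₂ C₁ C₂ C₃ h) (hL' : 0 ≤ L * (2 + 4 * L * C₃ + C₂))
    {B : Set (EuclideanSpace ℝ (Fin n))}
    (hB : B ⊆ axialCylinder e ρ 1) (hBo : IsOpen B) (hBc : Convex ℝ B)
    {f : EuclideanSpace ℝ (Fin n) → ℝ} (hf : ContDiff ℝ 1 f) :
    ENNReal.ofReal (C₁ * h / 2) * ∫⁻ z in shellMap e Q Ψ b₁ b₂ '' B,
      ∫⁻ w in shellMap e Q Ψ b₁ b₂ '' B, ‖f z - f w‖ₑ ^ 2 ≤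
    ENNReal.ofReal (2 * (C₂ * h)) ^ 2 * ENNReal.ofReal (chartConst n ρ L C₂ C₃) *
      volume (axialCylinder e ρ 1) *
      ∫⁻ z in shellMap e Q Ψ b₁ b₂ '' B, ‖fderiv ℝ f z‖ₑ ^ 2 := by
  set Φ := shellMap e Q Ψ b₁ b₂
  have hint := (hc.setLIntegral_image_le hC₁ hh hh1 hhρ hb₁ hb₂ hB hBo.measurableSet).2
  have hd := fun ζ (hζ : ζ ∈ B) =>
    hc.exists_hasFDerivAt_shellMap hC₁ hh hh1 hhρ hb₁ hb₂ (hB hζ)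
  choose! Φ' h1 h2 h3 h4 using hd
  have key := poincare_comp hBc hBo h1 (L := L * (2 + 4 * L * C₃ + C₂)) (R := 2 * (ρ + 1)) hL' h2
    (fun z hz w hw => by
      have e1 := norm_lt_of_mem_axialCylinder hc.norm_axis (hB hz)
      have e2 := norm_lt_of_mem_axialCylinder hc.norm_axis (hB hw)
      linarith [norm_sub_le w z]) hf
  set a : ℝ≥0∞ := ENNReal.ofReal (2 * (C₂ * h))
  set c : ℝ≥0∞ := ENNReal.ofReal (C₁ * h / 2)
  have hconst : ENNReal.ofReal (L * (2 + 4 * L * C₃ + C₂) * (2 * (ρ + 1))) ^ 2 *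
      2 ^ (Module.finrank ℝ (EuclideanSpace ℝ (Fin n)) + 1) =
      ENNReal.ofReal (chartConst n ρ L C₂ C₃) := by
    have hρ := hc.radius_pos
    rw [chartConst, ENNReal.ofReal_mul (sq_nonneg _), ENNReal.ofReal_pow (by positivity),
      ENNReal.ofReal_pow (by norm_num), finrank_euclideanSpace_fin, ENNReal.ofReal_ofNat]
  rw [hconst] at key
  calc c * ∫⁻ z in Φ '' B, ∫⁻ w in Φ '' B, ‖f z - f w‖ₑ ^ 2
      ≤ c * (a * ∫⁻ z in B, ∫⁻ w in Φ '' B, ‖f (Φ z) - f w‖ₑ ^ 2) := by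
        gcongr
        exact (hint _).1
    _ ≤ c * (a * ∫⁻ z in B, a * ∫⁻ w in B, ‖f (Φ z) - f (Φ w)‖ₑ ^ 2) := by
        gcongr
        exact (hint _).1
    _ = a ^ 2 * (c * ∫⁻ z in B, ∫⁻ w in B, ‖f (Φ z) - f (Φ w)‖ₑ ^ 2) := by
        rw [lintegral_const_mul' _ _ ENNReal.ofReal_ne_top]
        ring
    _ ≤ a ^ 2 * (c * (ENNReal.ofReal (chartConst n ρ L C₂ C₃) * volume (axialCylinder e ρ 1) *
          ∫⁻ z in B, ‖fderiv ℝ f (Φ z)‖ₑ ^ 2)) := by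
        gcongr
        refine key.trans ?_
        gcongr
    _ = a ^ 2 * ENNReal.ofReal (chartConst n ρ L C₂ C₃) * volume (axialCylinder e ρ 1) *
          (c * ∫⁻ z in B, ‖fderiv ℝ f (Φ z)‖ₑ ^ 2) := by ring
    _ ≤ _ := by
        gcongr
        exact (hint _).2

/-- The Poincaré inequality over a chart, with a constant independent of the height. -/
theorem poincare_sobolev (hc : IsShellChart S ν O e ρ L Q Ψ) (hC₁ : 0 < C₁) (hC₂ : 0 < C₂)
    (hC₃ : 0 < C₃) (hh : 0 < h) (hh1 : h ≤ 1) (hhρ : C₂ * h ≤ ρ)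
    (hb₁ : HeightBounds S b₁ C₁ C₂ C₃ h) (hb₂ : HeightBounds S b₂ C₁ C₂ C₃ h)
    {Ω : Set (EuclideanSpace ℝ (Fin n))} (hΩ : IsOpen Ω) (hsub : thinShell (S ∩ O) ν b₁ b₂ ⊆ Ω)
    {u : EuclideanSpace ℝ (Fin n) → ℝ}
    {G : EuclideanSpace ℝ (Fin n) → EuclideanSpace ℝ (Fin n)} (hu : IsSobolevWithGradient Ω u G) :
    ∃ a : ℝ, ∫⁻ z in thinShell (S ∩ O) ν b₁ b₂, ‖u z - a‖ₑ ^ 2 ≤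
      ENNReal.ofReal (16 * C₂ ^ 2 / C₁ ^ 2 * chartConst n ρ L C₂ C₃) * ∫⁻ z in Ω, ‖G z‖ₑ ^ 2 := by
  have hL := hc.bound_nonneg
  have hρ := hc.radius_pos
  have himg := hc.image_shellMap hC₁ hh hb₁ hb₂
  have hopen := hc.isOpen_shell hhρ hb₁ hb₂
  set Φ := shellMap e Q Ψ b₁ b₂ with hΦ
  set D := axialCylinder e ρ 1 with hD
  set A := thinShell (S ∩ O) ν b₁ b₂ with hA
  have hDm : MeasurableSet D := (isOpen_axialCylinder e ρ 1).measurableSet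
  have hV0 : volume D ≠ 0 := volume_axialCylinder_ne_zero hρ one_pos
  have hV1 : volume D ≠ ⊤ := volume_axialCylinder_ne_top hc.norm_axis ρ 1
  obtain ⟨hv1, hv2⟩ := hc.volume_image_le hC₁ hh hh1 hhρ hb₁ hb₂ subset_rfl hDm
  rw [← hΦ, himg] at hv1 hv2
  have hc0 : ENNReal.ofReal (C₁ * h / 2) ≠ 0 := by
    rw [Ne, ENNReal.ofReal_eq_zero, not_le]; positivity
  have hA0 : volume A ≠ 0 := (lt_of_lt_of_le (ENNReal.mul_pos hc0 hV0) hv2).ne'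
  have hA1 : volume A ≠ ⊤ := (hv1.trans_lt (ENNReal.mul_lt_top ENNReal.ofReal_lt_top hV1.lt_top)).ne
  set K : ℝ := chartConst n ρ L C₂ C₃ with hK
  have hK0 : 0 ≤ K := by rw [hK, chartConst]; positivity
  set lam : ℕ → ℝ := fun k => (k + 1 : ℝ) / (k + 1 + 1) with hlam
  have hlam1 : ∀ k, lam k < 1 := fun k => by
    rw [hlam]; simp only; rw [div_lt_one (by positivity)]; linarith
  have hlam0 : ∀ k, 0 < lam k := fun k => by rw [hlam]; positivity
  have hlamt : Tendsto lam atTop (𝓝 1) :=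
    (tendsto_natCast_div_add_atTop (1 : ℝ)).comp (tendsto_add_atTop_nat 1) |>.congr fun k => by
      simp [hlam]
  -- Slightly smaller cylinders are still open and convex, and their closures are compact in `D`.
  -- Their images thus leave room in `Ω` for mollification.
  set Dk : ℕ → Set (EuclideanSpace ℝ (Fin n)) := fun k => axialCylinder e (lam k * ρ) (lam k)
  have hDk : ∀ k, Dk k ⊆ D := fun k =>
    axialCylinder_mono e (by nlinarith [hlam1 k]) (hlam1 k).le
  have hpair : ∫⁻ z in A, ∫⁻ w in A, ‖u z - u w‖ₑ ^ 2 ≤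
      ENNReal.ofReal (2 * (C₂ * h)) ^ 2 * ENNReal.ofReal K * volume D /
        ENNReal.ofReal (C₁ * h / 2) * ∫⁻ z in Ω, ‖G z‖ₑ ^ 2 := by
    refine pairwise_poincare_of_smooth hΩ hu (Ak := fun k => Φ '' Dk k)
      (K := fun k => Φ '' {ζ | ‖transverse e ζ‖ ≤ lam k * ρ ∧ |(inner ℝ e ζ : ℝ)| ≤ lam k})
      hsub hopen.measurableSet ?_ ?_ ?_ ?_ ?_ ?_
    · intro k
      refine (isCompact_closed_axialCylinder hc.norm_axis _ _).image_of_continuousOn fun ζ hζ => ?_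
      have hζ' : ζ ∈ D := ⟨hζ.1.trans_lt (by nlinarith [hlam1 k]), hζ.2.trans_lt (hlam1 k)⟩
      obtain ⟨Φ', hΦ', -⟩ := hc.exists_hasFDerivAt_shellMap hC₁ hh hh1 hhρ hb₁ hb₂ hζ'
      exact hΦ'.continuousAt.continuousWithinAt
    · intro k
      refine subset_trans ?_ (himg.subset.trans hsub)
      refine image_mono fun ζ hζ => ?_
      exact ⟨hζ.1.trans_lt (by nlinarith [hlam1 k]), hζ.2.trans_lt (hlam1 k)⟩
    · exact fun k => image_mono fun ζ hζ => ⟨hζ.1.le, hζ.2.le⟩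
    · exact fun k => (hc.setLIntegral_image_le hC₁ hh hh1 hhρ hb₁ hb₂ (hDk k)
        (isOpen_axialCylinder _ _ _).measurableSet).1
    · intro z hz
      rw [← himg] at hz
      obtain ⟨ζ, hζ, rfl⟩ := hz
      have e1 : ∀ᶠ k in atTop, ‖transverse e ζ‖ < lam k * ρ := by
        have := hlamt.mul_const ρ
        rw [one_mul] at this
        exact this.eventually_const_lt hζ.1
      filter_upwards [e1, hlamt.eventually_const_lt hζ.2] with k h1 h2
      exact mem_image_of_mem _ ⟨h1, h2⟩
    · intro k f hf
      have h1 := hc.poincare_smooth hC₁ hh hh1 hhρ hb₁ hb₂ (by positivity) (hDk k)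
        (isOpen_axialCylinder _ _ _) (convex_axialCylinder _ _ _)
        (hf.of_le (by exact_mod_cast le_top))
      rw [mul_comm, ← ENNReal.le_div_iff_mul_le (Or.inl hc0) (Or.inl ENNReal.ofReal_ne_top)] at h1
      refine h1.trans (le_of_eq ?_)
      rw [ENNReal.mul_div_right_comm]
  refine exists_const_of_pairwise_poincare hA0 hA1 (hu.memLp.1.mono_measure
    (Measure.restrict_mono hsub le_rfl)) ?_ hpair
  refine le_trans ?_ (mul_le_mul_right hv2 _)
  -- The pairwise constant is of order `h ^ 2 / h`, and `volume A` is at least `C₁ * h / 2` times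
  -- `volume D`. The remaining quotient `(2 * C₂) ^ 2 / (C₁ / 2) ^ 2` gives `16 * C₂ ^ 2 / C₁ ^ 2`.
  have hcst : ENNReal.ofReal (2 * (C₂ * h)) ^ 2 * ENNReal.ofReal K / ENNReal.ofReal (C₁ * h / 2) =
      ENNReal.ofReal (16 * C₂ ^ 2 / C₁ ^ 2 * K) * ENNReal.ofReal (C₁ * h / 2) := by
    rw [← ENNReal.ofReal_pow (by positivity), ← ENNReal.ofReal_mul (by positivity),
      ← ENNReal.ofReal_div_of_pos (by positivity), ← ENNReal.ofReal_mul (by positivity)]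
    congr 1
    field_simp
    ring
  refine le_of_eq ?_
  rw [ENNReal.mul_div_right_comm, hcst]
  ring

/-- Overlapping charts: the overlap of the shells has a fixed proportion of the volume. -/
theorem exists_volume_overlap (hc : IsShellChart S ν O e ρ L Q Ψ) (hC₁ : 0 < C₁) (hC₂ : 0 < C₂)
    {O' : Set (EuclideanSpace ℝ (Fin n))} (hO' : IsOpen O') (hne : (S ∩ O ∩ O').Nonempty) :
    ∃ M : ℝ≥0∞, M ≠ ⊤ ∧ ∀ (h : ℝ) (b₁ b₂ : EuclideanSpace ℝ (Fin n) → ℝ), 0 < h → h ≤ 1 →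
      C₂ * h ≤ ρ → HeightBounds S b₁ C₁ C₂ C₃ h → HeightBounds S b₂ C₁ C₂ C₃ h →
      volume (thinShell (S ∩ O) ν b₁ b₂) ≤
        M * volume (thinShell (S ∩ O) ν b₁ b₂ ∩ thinShell (S ∩ O') ν b₁ b₂) := by
  set D := axialCylinder e ρ 1 with hD
  have hDm : MeasurableSet D := (isOpen_axialCylinder e ρ 1).measurableSet
  have hV1 : volume D ≠ ⊤ := volume_axialCylinder_ne_top hc.norm_axis ρ 1
  -- `W` does not depend on the heights, and it is open and nonempty, so it has positive volume. The
  -- images of `W` and `D` both have volume of order `h`, which makes the ratio uniform.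
  set W := D ∩ Q ⁻¹' O' with hW
  have hQc : ContinuousOn Q D := fun ζ hζ =>
    (hc.hasFDerivAt_base hζ.1).continuousAt.continuousWithinAt
  have hWo : IsOpen W := hQc.isOpen_inter_preimage (isOpen_axialCylinder e ρ 1) hO'
  have hWne : W.Nonempty := by
    obtain ⟨y, hy, hyO'⟩ := hne
    obtain ⟨ζ, hζ, rfl⟩ := hc.base_surj y hy
    refine ⟨transverse e ζ, ⟨(hc.transverse_mem hζ.1).1, ?_⟩, ?_⟩
    · rw [inner_transverse hc.norm_axis, abs_zero]
      exact one_pos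
    · rwa [mem_preimage, hc.base_transverse]
  have hW0 : volume W ≠ 0 := (hWo.measure_pos volume hWne).ne'
  have hW1 : volume W ≠ ⊤ := ((measure_mono inter_subset_left).trans_lt hV1.lt_top).ne
  refine ⟨ENNReal.ofReal (4 * C₂ / C₁) * (volume D / volume W),
    ENNReal.mul_ne_top ENNReal.ofReal_ne_top (ENNReal.div_ne_top hV1 hW0), ?_⟩
  intro h b₁ b₂ hh hh1 hhρ hb₁ hb₂
  have himg := hc.image_shellMap hC₁ hh hb₁ hb₂
  have h1 := (hc.volume_image_le hC₁ hh hh1 hhρ hb₁ hb₂ subset_rfl hDm).1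
  have h2 := (hc.volume_image_le hC₁ hh hh1 hhρ hb₁ hb₂ (B := W) inter_subset_left
    hWo.measurableSet).2
  rw [himg] at h1
  have hsub : shellMap e Q Ψ b₁ b₂ '' W ⊆
      thinShell (S ∩ O) ν b₁ b₂ ∩ thinShell (S ∩ O') ν b₁ b₂ := by
    refine subset_inter ((image_mono inter_subset_left).trans himg.subset) ?_
    rintro _ ⟨ζ, ⟨hζ, hζO'⟩, rfl⟩
    have hm := (hc.base_mem' hζ.1).1
    have h4 := (hb₁ _ hm).1
    have h5 := (hb₂ _ hm).1
    have h6 : 0 < C₁ * h := by positivity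
    have h7 := abs_lt.1 hζ.2
    refine ⟨Q ζ, ⟨hm, hζO'⟩, _, ?_, ?_, hc.shellMap_eq ζ⟩ <;> nlinarith
  calc volume (thinShell (S ∩ O) ν b₁ b₂) ≤ ENNReal.ofReal (2 * (C₂ * h)) * volume D := h1
    _ = ENNReal.ofReal (4 * C₂ / C₁) * (volume D / volume W) *
          (ENNReal.ofReal (C₁ * h / 2) * volume W) := by
        have e1 : ENNReal.ofReal (2 * (C₂ * h)) =
            ENNReal.ofReal (4 * C₂ / C₁) * ENNReal.ofReal (C₁ * h / 2) := by
          rw [← ENNReal.ofReal_mul (by positivity)]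
          congr 1
          field_simp
          ring
        have e2 : volume D = volume D / volume W * volume W := (ENNReal.div_mul_cancel hW0 hW1).symm
        conv_lhs => rw [e1, e2]
        ring
    _ ≤ _ := by
        gcongr
        exact h2.trans (measure_mono hsub)

end IsShellChart

end ShellPoincare

/-! ### Gluing along the connected surface -/

section Gluing

open Filter Topology

theorem enorm_add_sq_le (x y : ℝ) : ‖x + y‖ₑ ^ 2 ≤ 2 * ‖x‖ₑ ^ 2 + 2 * ‖y‖ₑ ^ 2 := by
  simp only [Real.enorm_eq_ofReal_abs]
  rw [← ENNReal.ofReal_pow (abs_nonneg _), ← ENNReal.ofReal_pow (abs_nonneg _),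
    ← ENNReal.ofReal_pow (abs_nonneg _), ← ENNReal.ofReal_ofNat 2,
    ← ENNReal.ofReal_mul (by norm_num), ← ENNReal.ofReal_mul (by norm_num),
    ← ENNReal.ofReal_add (by positivity) (by positivity)]
  refine ENNReal.ofReal_le_ofReal ?_
  rw [sq_abs, sq_abs, sq_abs]
  nlinarith [sq_nonneg (x - y)]

/-- Two Poincaré inequalities glue if the overlap is a fixed proportion of one of the sets. -/
theorem lintegral_union_le_of_overlap {α : Type*} [MeasurableSpace α] {μ : Measure α} {A B : Set α}
    {u : α → ℝ} (hu : AEStronglyMeasurable u (μ.restrict A)) {a b : ℝ} {M I c₁ c₂ : ℝ≥0∞}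
    (hM : μ B ≤ M * μ (B ∩ A)) (hA : ∫⁻ z in A, ‖u z - a‖ₑ ^ 2 ∂μ ≤ c₁ * I)
    (hB : ∫⁻ z in B, ‖u z - b‖ₑ ^ 2 ∂μ ≤ c₂ * I) :
    ∫⁻ z in A ∪ B, ‖u z - a‖ₑ ^ 2 ∂μ ≤ (c₁ + (2 * c₂ + 4 * M * (c₁ + c₂))) * I := by
  -- On the overlap `u` is close to both constants, which bounds their difference there. The
  -- hypothesis `hM` then carries this bound to all of `B`.
  have h1 : ‖b - a‖ₑ ^ 2 * μ (B ∩ A) ≤ 2 * (c₁ * I) + 2 * (c₂ * I) := by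
    have hm : AEMeasurable (fun z => 2 * ‖u z - a‖ₑ ^ 2) (μ.restrict (B ∩ A)) :=
      (((hu.mono_measure (Measure.restrict_mono inter_subset_right le_rfl)).sub
        aestronglyMeasurable_const).enorm.pow_const 2).const_mul 2
    calc ‖b - a‖ₑ ^ 2 * μ (B ∩ A) = ∫⁻ _ in B ∩ A, ‖b - a‖ₑ ^ 2 ∂μ := (setLIntegral_const _ _).symm
      _ ≤ ∫⁻ z in B ∩ A, (2 * ‖u z - a‖ₑ ^ 2 + 2 * ‖u z - b‖ₑ ^ 2) ∂μ := by
          refine lintegral_mono fun z => ?_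
          have := enorm_add_sq_le (u z - a) (-(u z - b))
          rw [enorm_neg] at this
          refine le_trans (le_of_eq ?_) this
          congr 2
          ring
      _ = 2 * ∫⁻ z in B ∩ A, ‖u z - a‖ₑ ^ 2 ∂μ + 2 * ∫⁻ z in B ∩ A, ‖u z - b‖ₑ ^ 2 ∂μ := by
          rw [lintegral_add_left' hm, lintegral_const_mul' _ _ (by simp),
            lintegral_const_mul' _ _ (by simp)]
      _ ≤ _ := by
          gcongr
          · exact (lintegral_mono_set inter_subset_right).trans hA
          · exact (lintegral_mono_set inter_subset_left).trans hB
  have h2 : ∫⁻ z in B, ‖u z - a‖ₑ ^ 2 ∂μ ≤ 2 * (c₂ * I) + 2 * (M * (2 * (c₁ * I) + 2 * (c₂ * I))) := by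
    calc ∫⁻ z in B, ‖u z - a‖ₑ ^ 2 ∂μ
        ≤ ∫⁻ z in B, (2 * ‖u z - b‖ₑ ^ 2 + 2 * ‖b - a‖ₑ ^ 2) ∂μ := by
          refine lintegral_mono fun z => ?_
          refine le_trans (le_of_eq ?_) (enorm_add_sq_le (u z - b) (b - a))
          congr 2
          ring
      _ = 2 * ∫⁻ z in B, ‖u z - b‖ₑ ^ 2 ∂μ + 2 * (‖b - a‖ₑ ^ 2 * μ B) := by
          rw [lintegral_add_right _ measurable_const, lintegral_const_mul' _ _ (by simp),
            setLIntegral_const, mul_assoc]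
      _ ≤ _ := by
          refine add_le_add (mul_le_mul_right hB _) (mul_le_mul_right ?_ _)
          calc ‖b - a‖ₑ ^ 2 * μ B ≤ ‖b - a‖ₑ ^ 2 * (M * μ (B ∩ A)) := by gcongr
            _ = M * (‖b - a‖ₑ ^ 2 * μ (B ∩ A)) := by ring
            _ ≤ _ := mul_le_mul_right h1 _
  calc ∫⁻ z in A ∪ B, ‖u z - a‖ₑ ^ 2 ∂μ
      ≤ ∫⁻ z in A, ‖u z - a‖ₑ ^ 2 ∂μ + ∫⁻ z in B, ‖u z - a‖ₑ ^ 2 ∂μ := lintegral_union_le _ _ _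
    _ ≤ c₁ * I + (2 * (c₂ * I) + 2 * (M * (2 * (c₁ * I) + 2 * (c₂ * I)))) := add_le_add hA h2
    _ = _ := by ring

variable {n : ℕ}

theorem thinShell_mono {S T : Set (EuclideanSpace ℝ (Fin n))} (h : S ⊆ T)
    (ν : EuclideanSpace ℝ (Fin n) → EuclideanSpace ℝ (Fin n))
    (a b : EuclideanSpace ℝ (Fin n) → ℝ) : thinShell S ν a b ⊆ thinShell T ν a b :=
  fun _ ⟨x, hx, hz⟩ => ⟨x, h hx, hz⟩

theorem thinShell_union (S T : Set (EuclideanSpace ℝ (Fin n)))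
    (ν : EuclideanSpace ℝ (Fin n) → EuclideanSpace ℝ (Fin n))
    (a b : EuclideanSpace ℝ (Fin n) → ℝ) :
    thinShell (S ∪ T) ν a b = thinShell S ν a b ∪ thinShell T ν a b := by
  ext z
  constructor
  · rintro ⟨x, hx | hx, hz⟩
    exacts [Or.inl ⟨x, hx, hz⟩, Or.inr ⟨x, hx, hz⟩]
  · rintro (h | h)
    exacts [thinShell_mono subset_union_left ν a b h, thinShell_mono subset_union_right ν a b h]

/-- The uniform Poincaré inequality for the part of the shell over `S ∩ T`. -/
def UniformPoincareOn (S : Set (EuclideanSpace ℝ (Fin n)))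
    (ν : EuclideanSpace ℝ (Fin n) → EuclideanSpace ℝ (Fin n)) (C₁ C₂ C₃ : ℝ)
    (T : Set (EuclideanSpace ℝ (Fin n))) : Prop :=
  ∃ c : ℝ≥0∞, c ≠ ⊤ ∧ ∃ hbar : ℝ, 0 < hbar ∧
    ∀ (h : ℝ) (b₁ b₂ : EuclideanSpace ℝ (Fin n) → ℝ), 0 < h → h < hbar →
      HeightBounds S b₁ C₁ C₂ C₃ h → HeightBounds S b₂ C₁ C₂ C₃ h →
      IsOpen (thinShell S ν b₁ b₂) →
      ∀ (u : EuclideanSpace ℝ (Fin n) → ℝ) (G : EuclideanSpace ℝ (Fin n) → EuclideanSpace ℝ (Fin n)),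
        IsSobolevWithGradient (thinShell S ν b₁ b₂) u G →
        ∃ a : ℝ, ∫⁻ z in thinShell (S ∩ T) ν b₁ b₂, ‖u z - a‖ₑ ^ 2 ≤
          c * ∫⁻ z in thinShell S ν b₁ b₂, ‖G z‖ₑ ^ 2

variable {S O T : Set (EuclideanSpace ℝ (Fin n))}
  {ν Q Ψ : EuclideanSpace ℝ (Fin n) → EuclideanSpace ℝ (Fin n)} {e : EuclideanSpace ℝ (Fin n)}
  {ρ L C₁ C₂ C₃ : ℝ}

theorem IsShellChart.uniformPoincareOn (hc : IsShellChart S ν O e ρ L Q Ψ) (hC₁ : 0 < C₁)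
    (hC₂ : 0 < C₂) (hC₃ : 0 < C₃) : UniformPoincareOn S ν C₁ C₂ C₃ O := by
  refine ⟨ENNReal.ofReal (16 * C₂ ^ 2 / C₁ ^ 2 * chartConst n ρ L C₂ C₃),
    ENNReal.ofReal_ne_top, min 1 (ρ / C₂),
    lt_min one_pos (div_pos hc.radius_pos hC₂), ?_⟩
  intro h b₁ b₂ hh hhb hb₁ hb₂ hΩ u G hu
  have h1 : h ≤ 1 := (hhb.trans_le (min_le_left _ _)).le
  have h2 : C₂ * h ≤ ρ := by
    rw [mul_comm, ← le_div_iff₀ hC₂]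
    exact (hhb.trans_le (min_le_right _ _)).le
  exact hc.poincare_sobolev hC₁ hC₂ hC₃ hh h1 h2 hb₁ hb₂ hΩ
    (thinShell_mono inter_subset_left ν b₁ b₂) hu

/-- Both inequalities are measured against the gradient on the entire shell, so gluing changes only
the constants. The overlap constant depends on the charts and not on `h`, so the result is again
uniform. -/
theorem UniformPoincareOn.union (hT : UniformPoincareOn S ν C₁ C₂ C₃ T) (hTo : IsOpen T)
    (hc : IsShellChart S ν O e ρ L Q Ψ) (hC₁ : 0 < C₁) (hC₂ : 0 < C₂) (hC₃ : 0 < C₃)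
    (hne : (S ∩ O ∩ T).Nonempty) : UniformPoincareOn S ν C₁ C₂ C₃ (T ∪ O) := by
  obtain ⟨c₁, hc₁, h₁, hh₁, H₁⟩ := hT
  obtain ⟨c₂, hc₂, h₂, hh₂, H₂⟩ := hc.uniformPoincareOn hC₁ hC₂ hC₃
  obtain ⟨M, hM, H⟩ := hc.exists_volume_overlap (C₃ := C₃) hC₁ hC₂ hTo hne
  refine ⟨c₁ + (2 * c₂ + 4 * M * (c₁ + c₂)), ?_, min (min h₁ h₂) (min 1 (ρ / C₂)),
    lt_min (lt_min hh₁ hh₂) (lt_min one_pos (div_pos hc.radius_pos hC₂)), ?_⟩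
  · finiteness
  intro h b₁ b₂ hh hhb hb₁ hb₂ hΩ u G hu
  have e1 : h < h₁ := hhb.trans_le ((min_le_left _ _).trans (min_le_left _ _))
  have e2 : h < h₂ := hhb.trans_le ((min_le_left _ _).trans (min_le_right _ _))
  have e3 : h ≤ 1 := (hhb.trans_le ((min_le_right _ _).trans (min_le_left _ _))).le
  have e4 : C₂ * h ≤ ρ := by
    rw [mul_comm, ← le_div_iff₀ hC₂]
    exact (hhb.trans_le ((min_le_right _ _).trans (min_le_right _ _))).le
  obtain ⟨a, ha⟩ := H₁ h b₁ b₂ hh e1 hb₁ hb₂ hΩ u G hu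
  obtain ⟨b, hb⟩ := H₂ h b₁ b₂ hh e2 hb₁ hb₂ hΩ u G hu
  refine ⟨a, ?_⟩
  rw [inter_union_distrib_left, thinShell_union]
  exact lintegral_union_le_of_overlap (hu.memLp.1.mono_measure
    (Measure.restrict_mono (thinShell_mono inter_subset_left ν b₁ b₂) le_rfl))
    (H h b₁ b₂ hh e3 e4 hb₁ hb₂) ha hb

/-- A largest subfamily of a finite chart cover on whose union the inequality holds must be the
entire family; otherwise connectedness provides a further chart meeting it. The second conclusion
supplies the openness of the shell that the first one assumes. -/
theorem uniformPoincareOn_univ (hS_compact : IsCompact S) (hS_connected : IsConnected S)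
    (hS : IsSmoothHypersurface S) (hν : IsUnitNormalField S ν) (hC₁ : 0 < C₁) (hC₂ : 0 < C₂)
    (hC₃ : 0 < C₃) :
    UniformPoincareOn S ν C₁ C₂ C₃ univ ∧ ∃ hbar : ℝ, 0 < hbar ∧
      ∀ (h : ℝ) (b₁ b₂ : EuclideanSpace ℝ (Fin n) → ℝ), 0 < h → h < hbar →
        HeightBounds S b₁ C₁ C₂ C₃ h → HeightBounds S b₂ C₁ C₂ C₃ h →
        IsOpen (thinShell S ν b₁ b₂) := by
  classical
  have hchart := fun x (hx : x ∈ S) => exists_isShellChart hS hν hx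
  choose! O e ρ L Q Ψ hxO hc using hchart
  obtain ⟨t, htS, ht⟩ := hS_compact.elim_nhds_subcover O
    fun x hx => (hc x hx).isOpen.mem_nhds (hxO x hx)
  have hopen : ∀ s : Finset (EuclideanSpace ℝ (Fin n)), s ⊆ t → IsOpen (⋃ x ∈ s, O x) :=
    fun s hs => isOpen_biUnion fun x hx => (hc x (htS x (hs hx))).isOpen
  obtain ⟨y, hy⟩ := hS_connected.nonempty
  obtain ⟨x₀, hx₀, -⟩ := mem_iUnion₂.1 (ht hy)
  set good : Finset (Finset (EuclideanSpace ℝ (Fin n))) := t.powerset.filter fun s =>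
    s.Nonempty ∧ UniformPoincareOn S ν C₁ C₂ C₃ (⋃ x ∈ s, O x) with hgood
  have hgood0 : {x₀} ∈ good := by
    rw [hgood, Finset.mem_filter, Finset.mem_powerset, Finset.singleton_subset_iff]
    refine ⟨hx₀, Finset.singleton_nonempty _, ?_⟩
    simpa using (hc x₀ (htS x₀ hx₀)).uniformPoincareOn hC₁ hC₂ hC₃
  obtain ⟨s, hs, hmax⟩ := good.exists_max_image Finset.card ⟨_, hgood0⟩
  rw [hgood, Finset.mem_filter, Finset.mem_powerset] at hs
  obtain ⟨hst, hsne, hsP⟩ := hs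
  obtain ⟨x₁, hx₁⟩ := id hsne
  have hcover : t ⊆ s := by
    by_contra hns
    obtain ⟨x₂, hx₂t, hx₂s⟩ := Finset.not_subset.1 hns
    have hcov : S ⊆ (⋃ x ∈ s, O x) ∪ ⋃ x ∈ t \ s, O x := by
      intro z hz
      obtain ⟨x, hx, hzx⟩ := mem_iUnion₂.1 (ht hz)
      by_cases hxs : x ∈ s
      · exact Or.inl (mem_biUnion hxs hzx)
      · exact Or.inr (mem_iUnion₂.2 ⟨x, Finset.mem_sdiff.2 ⟨hx, hxs⟩, hzx⟩)
    -- The charts inside and outside `s` form two open sets covering `S`, each meeting it at a chart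
    -- centre. They must meet on `S`, so some chart outside `s` can be glued on, contradicting
    -- maximality.
    obtain ⟨z, hzS, hz1, hz2⟩ := hS_connected.isPreconnected _ _ (hopen s hst)
      (hopen _ Finset.sdiff_subset) hcov
      ⟨x₁, htS x₁ (hst hx₁), mem_iUnion₂.2 ⟨x₁, hx₁, hxO x₁ (htS x₁ (hst hx₁))⟩⟩
      ⟨x₂, htS x₂ hx₂t, mem_iUnion₂.2 ⟨x₂, Finset.mem_sdiff.2 ⟨hx₂t, hx₂s⟩, hxO x₂ (htS x₂ hx₂t)⟩⟩
    obtain ⟨x, hx, hzx⟩ := mem_iUnion₂.1 hz2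
    obtain ⟨hxt, hxs⟩ := Finset.mem_sdiff.1 hx
    have hnew := hsP.union (hopen s hst) (hc x (htS x hxt)) hC₁ hC₂ hC₃ ⟨z, ⟨hzS, hzx⟩, hz1⟩
    have hmem : insert x s ∈ good := by
      rw [hgood, Finset.mem_filter, Finset.mem_powerset]
      refine ⟨Finset.insert_subset hxt hst, Finset.insert_nonempty _ _, ?_⟩
      rwa [Finset.set_biUnion_insert, union_comm]
    have := hmax _ hmem
    rw [Finset.card_insert_of_notMem hxs] at this
    omega
  have hcov : S ∩ ⋃ x ∈ s, O x = S ∩ univ := by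
    rw [inter_univ]
    exact inter_eq_left.2 (ht.trans (biUnion_subset_biUnion_left hcover))
  refine ⟨?_, ?_⟩
  · rw [UniformPoincareOn, hcov] at hsP
    exact hsP
  -- Below this threshold `C₂ * h ≤ ρ x` in every chart, so the shell is a union of open pieces.
  · refine ⟨s.inf' hsne fun x => ρ x / C₂, ?_, ?_⟩
    · rw [Finset.lt_inf'_iff]
      exact fun x hx => div_pos (hc x (htS x (hst hx))).radius_pos hC₂
    · intro h b₁ b₂ _ hhb hb₁ hb₂
      rw [Finset.lt_inf'_iff] at hhb
      have : thinShell S ν b₁ b₂ = ⋃ x ∈ s, thinShell (S ∩ O x) ν b₁ b₂ := by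
        refine subset_antisymm ?_ (iUnion₂_subset fun x _ => thinShell_mono inter_subset_left _ _ _)
        rintro z ⟨y, hy, hz⟩
        rw [inter_univ] at hcov
        obtain ⟨x, hx, hyx⟩ := mem_iUnion₂.1 (hcov.symm.subset hy).2
        exact mem_iUnion₂.2 ⟨x, hx, y, ⟨hy, hyx⟩, hz⟩
      rw [this]
      refine isOpen_biUnion fun x hx => ?_
      refine (hc x (htS x (hst hx))).isOpen_shell ?_ hb₁ hb₂
      rw [mul_comm, ← le_div_iff₀ hC₂]
      exact (hhb x hx).le

theorem eLpNorm_two_sq {α F : Type*} [MeasurableSpace α] [NormedAddCommGroup F] (μ : Measure α)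
    (f : α → F) : eLpNorm f 2 μ ^ 2 = ∫⁻ z, ‖f z‖ₑ ^ 2 ∂μ := by
  simpa using eLpNorm_nnreal_pow_eq_lintegral (f := f) (μ := μ) (p := 2) two_ne_zero

end Gluing

theorem mainTheorem8 {n : ℕ} (S : Set (EuclideanSpace ℝ (Fin n)))
    (hS_compact : IsCompact S) (hS_connected : IsConnected S) (hS : IsSmoothHypersurface S)
    (ν : EuclideanSpace ℝ (Fin n) → EuclideanSpace ℝ (Fin n)) (hν : IsUnitNormalField S ν)
    (C₁ C₂ C₃ : ℝ) (hC₁ : 0 < C₁) (hC₂ : 0 < C₂) (hC₃ : 0 < C₃) :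
    ∃ C : ℝ, 0 < C ∧ ∃ hbar : ℝ, 0 < hbar ∧
      ∀ (g₁ g₂ : ℝ → EuclideanSpace ℝ (Fin n) → ℝ) (h₀ : ℝ), 0 < h₀ →
        IsSmoothPositiveFamily S g₁ → IsSmoothPositiveFamily S g₂ →
        ThicknessBounds S g₁ C₁ C₂ C₃ h₀ → ThicknessBounds S g₂ C₁ C₂ C₃ h₀ →
        ∀ h : ℝ, 0 < h → h < h₀ → h < hbar →
          ∀ (u : EuclideanSpace ℝ (Fin n) → ℝ)
            (G : EuclideanSpace ℝ (Fin n) → EuclideanSpace ℝ (Fin n)),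
            IsSobolevWithGradient (thinShell S ν (g₁ h) (g₂ h)) u G →
            ∃ a : ℝ,
              eLpNorm (fun z => u z - a) 2 (volume.restrict (thinShell S ν (g₁ h) (g₂ h))) ≤
                ENNReal.ofReal C *
                  eLpNorm G 2 (volume.restrict (thinShell S ν (g₁ h) (g₂ h))) := by
  obtain ⟨⟨c, hc, h₁, hh₁, H₁⟩, h₂, hh₂, H₂⟩ :=
    uniformPoincareOn_univ hS_compact hS_connected hS hν hC₁ hC₂ hC₃
  -- With `t = c.toReal`, the inequality `t ≤ (t + 1) ^ 2` replaces a square root and also makes the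
  -- constant positive.
  refine ⟨c.toReal + 1, by positivity, min h₁ h₂, lt_min hh₁ hh₂, ?_⟩
  intro g₁ g₂ h₀ _ _ _ hg₁ hg₂ h hh hh₀ hhb u G hu
  have hb₁ : HeightBounds S (g₁ h) C₁ C₂ C₃ h := hg₁ h hh hh₀
  have hb₂ : HeightBounds S (g₂ h) C₁ C₂ C₃ h := hg₂ h hh hh₀
  obtain ⟨a, ha⟩ := H₁ h _ _ hh (hhb.trans_le (min_le_left _ _)) hb₁ hb₂
    (H₂ h _ _ hh (hhb.trans_le (min_le_right _ _)) hb₁ hb₂) u G hu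
  refine ⟨a, ?_⟩
  rw [inter_univ, ← eLpNorm_two_sq, ← eLpNorm_two_sq] at ha
  rw [← ENNReal.pow_le_pow_left_iff two_ne_zero, mul_pow]
  refine ha.trans ?_
  gcongr
  rw [← ENNReal.ofReal_pow (by positivity)]
  refine ENNReal.le_ofReal_iff_toReal_le hc (by positivity) |>.2 ?_
  nlinarith [ENNReal.toReal_nonneg (a := c)]
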